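/- Theorem. There is a universal constant $C>0$ such that the following holds. Consider $r$ jobs and $m$ machines, where job $j\in[r]$ has size $p_{ij}\ge 0$ on machine $i\in[m]$, and let $p_{\max}=\max_{i,j}p_{ij}$. Let $\delta\in[0,1/2)$, and let $x=(x_{ij})$ be a fractional assignment, i.e. $x_{ij}\in[0,1]$ for all $i,j$ and $\sum_{i\in[m]}x_{ij}=1$ for every job $j$. Then there is a random vector $X=(X_{ij})$ such that (1) with probability $1$, $X$ is an integral assignment, i.e. $X_{ij}\in\{0,1\}$ for all $i,j$ and $\sum_{i}X_{ij}=1$ for every job $j$, and the load of every machine increases by at most $p_{\max}/(1-2\delta)$: $$\sum_{j}p_{ij}X_{ij}\;\le\;\sum_{j}p_{ij}x_{ij}+\frac{p_{\max}}{1-2\delta}\qquad\text{for all } i\in[m];$$ (2) $\mathbb{E}[X_{ij}]=x_{ij}$ for all $i,j$; (3) if $\delta>0$, then $X$ is $\beta$-concentrated around $x$ with $\beta=C/\delta\ge 1$, that is, for all real coefficients $a=(a_{ij})$ and all $t>0$, writing $S=\sum_{i,j}a_{ij}X_{ij}$ and $M=\max_{i,j}|a_{ij}|$, $$\Pr\bigl[S-\mathbb{E}[S]\ge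 t\bigr]\;\le\;\exp\left(-\frac{t^2/\beta}{2\bigl(\sum_{i,j}a_{ij}^2(x_{ij}-x_{ij}^2)+Mt/3\bigr)}\right)$$ (for $a=0$ the left side is $0$ and there is nothing to prove). -/

import Mathlib

namespace UnrelatedMachines

/-- The load of machine `i` under a (fractional or integral) assignment `x`, where job `j` has
size `p i j` on machine `i`. -/
noncomputable def load {m r : ℕ} (p x : Fin m → Fin r → ℝ) (i : Fin m) : ℝ :=
  ∑ j, p i j * x i j

/-- The maximum job size `max_{i,j} p i j` (equal to `0` if there is no machine or no job). -/
noncomputable def pmax {m r : ℕ} (p : Fin m → Fin r → ℝ) : ℝ :=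
  ⨆ e : Fin m × Fin r, p e.1 e.2

/-- A fractional solution of the assignment LP: `x i j ∈ [0,1]` and each job is assigned exactly
once in total. The load constraints `load p x i ≤ T` need not be listed: they hold for
`T = max_i load p x i`, and load increases are measured against the loads of `x` itself. -/
structure IsFractionalAssignment {m r : ℕ} (x : Fin m → Fin r → ℝ) : Prop where
  mem_Icc : ∀ i j, x i j ∈ Set.Icc (0 : ℝ) 1
  sum_eq_one : ∀ j, ∑ i, x i j = 1

/-- An integral assignment: `0`-`1` values, each job on exactly one machine. -/
structure IsIntegralAssignment {m r : ℕ} (X : Fin m → Fin r → ℝ) : Prop where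
  zero_or_one : ∀ i j, X i j = 0 ∨ X i j = 1
  sum_eq_one : ∀ j, ∑ i, X i j = 1

/-- `β`-concentration around the mean `x` of a finite family `X` of possibly dependent `0`-`1`
random variables: every linear function `∑ a_i X_i` satisfies Bernstein's inequality up to the
factor `β` in the exponent, with `M = max_i |a_i|`. -/
structure IsConcentrated {Ω ι : Type*} [MeasurableSpace Ω] [Fintype ι]
    (μ : MeasureTheory.Measure Ω) (X : ι → Ω → ℝ) (x : ι → ℝ) (β : ℝ) : Prop where
  one_le : 1 ≤ β
  measurable : ∀ i, Measurable (X i)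
  zero_or_one : ∀ i, ∀ᵐ ω ∂μ, X i ω = 0 ∨ X i ω = 1
  mean : ∀ i, ∫ ω, X i ω ∂μ = x i
  tail : ∀ (a : ι → ℝ) (t : ℝ), 0 < t →
    μ.real {ω | t ≤ (∑ i, a i * X i ω) - ∫ ω', (∑ i, a i * X i ω') ∂μ} ≤
      Real.exp (-((t ^ 2 / β) /
        (2 * ((∑ i, a i ^ 2 * (x i - x i ^ 2)) + (⨆ i, |a i|) * t / 3))))

end UnrelatedMachines

open Finset MeasureTheory

/-! The fractional assignment is rounded by a mean-preserving walk that moves only coordinates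
strictly between 0 and 1. Directions lie in the kernel of a constraint matrix that preserves the sum
of every open job and the load of every tight machine. A machine is released once the total size of
its supported jobs is at most its initial load plus the allowed increase. Its support can then only
shrink, so no later choice breaks the bound.

With n open coordinates and J open jobs, 2J ≤ n, and each tight machine carries more than 1/(1 - 2δ)
of the total n - J of 1 - y over the open coordinates. Hence there are at most (1 - δ)n constraints,
and the kernel has dimension at least δn (`card_constraints_le`). A subspace that large carries a
nonzero covariance U with δU ≼ diag U, by convex duality and a trace bound
(`exists_balanced_family`).

Steps ±s along such a family do not increase the mean of exp(⟨a, y⟩ + c ∑ a_i²(y_i - y_i²)) when |a|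
is small: the loss of the energy term pays for the variance of the linear term
(`sum_expPotential_step_le`). At 0-1 points the energy vanishes, so the potential bounds a moment
generating function, and Markov's inequality gives Bernstein's tail
(`isConcentrated_weightMeasure`).

No infinite walk is built. Finitely many steps round all but a fixed fraction of the mass; iterating
makes the missing mass tend to 0, and compactness of the weights yields an exact rounding
(`exists_isPartialRounding_of_progress`). -/

/-! ### Balanced covariances in large subspaces -/

/-- Trace bound: a quadratic form `∑ l, (B v) l ^ 2` that dominates `1 / η` times its own diagonal
form on a nonzero subspace `V` forces `finrank V < η * card ι`. -/
theorem finrank_lt_of_diagonal_lt {ι : Type} [Fintype ι] (V : Submodule ℝ (ι → ℝ))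
    (hV : 0 < Module.finrank ℝ V) (η : ℝ) (B : Matrix ι ι ℝ) (hg : ∀ i, 0 < ∑ l, B l i ^ 2)
    (h : ∀ v ∈ V, v ≠ 0 → ∑ i, (∑ l, B l i ^ 2) * v i ^ 2 < η * ∑ l, (∑ i, B l i * v i) ^ 2) :
    (Module.finrank ℝ V : ℝ) < η * Fintype.card ι := by
  set g : ι → ℝ := fun i => ∑ l, B l i ^ 2 with hgdef
  have hs : ∀ i, 0 < √(g i) := fun i => Real.sqrt_pos.2 (hg i)
  have hss : ∀ i, √(g i) * √(g i) = g i := fun i => Real.mul_self_sqrt (hg i).le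
  -- Scaling by `√(g i)` turns the diagonal form into the Euclidean norm; the rescaled rows `c l` of
  -- `B` then have squared norms summing to `card ι`, and Bessel's inequality for an orthonormal
  -- basis of `V'` bounds the trace.
  let D : (ι → ℝ) ≃ₗ[ℝ] EuclideanSpace ℝ ι :=
    (LinearEquiv.piCongrRight fun i => LinearEquiv.smulOfNeZero ℝ ℝ (√(g i)) (hs i).ne').trans
      (WithLp.linearEquiv 2 ℝ (ι → ℝ)).symm
  have hD : ∀ v i, D v i = √(g i) * v i := fun v i => rfl
  let V' := V.map (D : (ι → ℝ) →ₗ[ℝ] EuclideanSpace ℝ ι)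
  have hfr : Module.finrank ℝ V' = Module.finrank ℝ V := LinearEquiv.finrank_map_eq D V
  let e := stdOrthonormalBasis ℝ V'
  let u : Fin (Module.finrank ℝ V') → EuclideanSpace ℝ ι := fun k => (e k : EuclideanSpace ℝ ι)
  have hu : Orthonormal ℝ u := e.orthonormal.comp_linearIsometry V'.subtypeₗᵢ
  have hpos : 0 < Module.finrank ℝ V' := hfr ▸ hV
  let c : ι → EuclideanSpace ℝ ι := fun l => WithLp.toLp 2 fun i => B l i / √(g i)
  have hc : ∀ l, ‖c l‖ ^ 2 = ∑ i, B l i ^ 2 / g i := by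
    intro l
    rw [EuclideanSpace.real_norm_sq_eq]
    refine sum_congr rfl fun i _ => ?_
    simp only [c]
    rw [div_pow, pow_two (√(g i)), hss]
  have key : ∀ k, 1 < η * ∑ l, ‖inner ℝ (u k) (c l)‖ ^ 2 := by
    intro k
    obtain ⟨v, hv, hvu⟩ := (e k).2
    have hvu' : D v = u k := hvu
    have hn : ‖u k‖ ^ 2 = 1 := by rw [hu.1 k]; norm_num
    have hv0 : v ≠ 0 := by
      rintro rfl
      rw [map_zero] at hvu'
      rw [← hvu'] at hn
      simp at hn
    have h1 := h v hv hv0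
    have h2 : ∑ i, g i * v i ^ 2 = 1 := by
      rw [← hn, EuclideanSpace.real_norm_sq_eq]
      refine sum_congr rfl fun i _ => ?_
      rw [← hvu', hD, mul_pow, pow_two (√(g i)), hss]
    have h3 : ∀ l, ‖inner ℝ (u k) (c l)‖ ^ 2 = (∑ i, B l i * v i) ^ 2 := by
      intro l
      rw [Real.norm_eq_abs, sq_abs, ← hvu', PiLp.inner_apply]
      congr 1
      refine sum_congr rfl fun i _ => ?_
      rw [hD]
      simp only [c, RCLike.inner_apply, conj_trivial]
      have := (hs i).ne'
      field_simp
    rw [← h2]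
    simpa only [h3] using h1
  have hbessel : ∑ k, ∑ l, ‖inner ℝ (u k) (c l)‖ ^ 2 ≤ Fintype.card ι := by
    rw [sum_comm]
    calc ∑ l, ∑ k, ‖inner ℝ (u k) (c l)‖ ^ 2 ≤ ∑ l, ‖c l‖ ^ 2 :=
          sum_le_sum fun l _ => hu.sum_inner_products_le (c l)
      _ = ∑ i, ∑ l, B l i ^ 2 / g i := by simp only [hc]; exact sum_comm
      _ = ∑ i : ι, (1 : ℝ) := sum_congr rfl fun i _ => by
          rw [← sum_div]; exact div_self (hg i).ne'
      _ = _ := by simp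
  have hη : 0 < η := by
    by_contra hη
    have := key ⟨0, hpos⟩
    have h0 : 0 ≤ ∑ l, ‖inner ℝ (u ⟨0, hpos⟩) (c l)‖ ^ 2 := sum_nonneg fun _ _ => sq_nonneg _
    nlinarith
  have : Nonempty (Fin (Module.finrank ℝ V')) := ⟨⟨0, hpos⟩⟩
  calc (Module.finrank ℝ V : ℝ) = ∑ _k : Fin (Module.finrank ℝ V'), (1 : ℝ) := by simp [hfr]
    _ < ∑ k, η * ∑ l, ‖inner ℝ (u k) (c l)‖ ^ 2 :=
        sum_lt_sum_of_nonempty univ_nonempty fun k _ => key k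
    _ ≤ _ := by
        rw [← mul_sum]
        exact mul_le_mul_of_nonneg_left hbessel hη.le

theorem isCompact_gram_sphere (κ : Type) [Fintype κ] :
    IsCompact {M : Matrix κ κ ℝ | ∃ B : Matrix κ κ ℝ, ∑ k, ∑ l, B k l ^ 2 = 1 ∧
      M = B.transpose * B} := by
  have h : IsCompact {B : κ → κ → ℝ | ∑ k, ∑ l, B k l ^ 2 = 1} := by
    refine Metric.isCompact_of_isClosed_isBounded
      (isClosed_eq (by fun_prop) continuous_const) ?_
    refine (Metric.isBounded_closedBall (x := (0 : κ → κ → ℝ)) (r := 1)).subset fun B hB => ?_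
    rw [mem_closedBall_zero_iff, pi_norm_le_iff_of_nonneg zero_le_one]
    intro k
    rw [pi_norm_le_iff_of_nonneg zero_le_one]
    intro l
    rw [Real.norm_eq_abs, ← sq_le_one_iff_abs_le_one]
    have h1 : B k l ^ 2 ≤ ∑ l, B k l ^ 2 :=
      single_le_sum (f := fun l => B k l ^ 2) (fun _ _ => sq_nonneg _) (mem_univ l)
    have h2 : ∑ l, B k l ^ 2 ≤ ∑ k, ∑ l, B k l ^ 2 :=
      single_le_sum (f := fun k => ∑ l, B k l ^ 2)
        (fun _ _ => sum_nonneg fun _ _ => sq_nonneg _) (mem_univ k)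
    exact h1.trans (h2.trans (le_of_eq hB))
  have h2 : Continuous fun B : Matrix κ κ ℝ => B.transpose * B := by fun_prop
  convert h.image h2 using 1
  ext M
  constructor
  · rintro ⟨B, hB, rfl⟩; exact ⟨B, hB, rfl⟩
  · rintro ⟨B, hB, rfl⟩; exact ⟨B, hB, rfl⟩

theorem Matrix.PosSemidef.exists_transpose_mul_self {κ : Type} [Fintype κ] [DecidableEq κ]
    {M : Matrix κ κ ℝ} (hM : M.PosSemidef) : ∃ B : Matrix κ κ ℝ, M = B.transpose * B := by
  open scoped MatrixOrder Matrix.Norms.L2Operator in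
  obtain ⟨B, hB⟩ := CStarAlgebra.nonneg_iff_eq_star_mul_self.mp hM.nonneg
  exact ⟨B, hB⟩

theorem trace_transpose_mul_self_eq {κ : Type} [Fintype κ] (B : Matrix κ κ ℝ) :
    (B.transpose * B).trace = ∑ k, ∑ l, B k l ^ 2 := by
  rw [sum_comm]
  simp [Matrix.trace, Matrix.mul_apply, pow_two]

/-- A convex combination of Gram matrices is positive semidefinite, hence again a Gram matrix, and
the sum of squared entries of the factor is the trace, which is linear. -/
theorem convex_gram_sphere (κ : Type) [Fintype κ] :
    Convex ℝ {M : Matrix κ κ ℝ | ∃ B : Matrix κ κ ℝ, ∑ k, ∑ l, B k l ^ 2 = 1 ∧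
      M = B.transpose * B} := by
  classical
  rintro _ ⟨B, hB, rfl⟩ _ ⟨B', hB', rfl⟩ a b ha hb hab
  have hpsd : (a • (B.transpose * B) + b • (B'.transpose * B')).PosSemidef :=
    ((Matrix.posSemidef_conjTranspose_mul_self B).smul ha).add
      ((Matrix.posSemidef_conjTranspose_mul_self B').smul hb)
  obtain ⟨C, hC⟩ := hpsd.exists_transpose_mul_self
  refine ⟨C, ?_, hC⟩
  rw [← trace_transpose_mul_self_eq, ← hC]
  simp [trace_transpose_mul_self_eq, hB, hB', hab]

/-- A subspace of dimension at least `η * card ι` carries a nonzero covariance matrix `U` with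
`η U ≼ diag U`, written as a finite family of vectors of the subspace. -/
theorem exists_balanced_family {ι : Type} [Fintype ι] (V : Submodule ℝ (ι → ℝ))
    (hV : 0 < Module.finrank ℝ V) {η : ℝ} (hη : 0 ≤ η)
    (hdim : η * Fintype.card ι ≤ Module.finrank ℝ V) :
    ∃ v : Fin (Module.finrank ℝ V) → ι → ℝ, (∀ k, v k ∈ V) ∧ ∑ k, ∑ i, v k i ^ 2 = 1 ∧
      ∀ b : ι → ℝ, η * ∑ k, (∑ i, b i * v k i) ^ 2 ≤ ∑ k, ∑ i, b i ^ 2 * v k i ^ 2 := by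
  classical
  set d := Module.finrank ℝ V with hd
  let e := Module.finBasis ℝ V
  let Q : Matrix (Fin d) ι ℝ := fun k => (e k : ι → ℝ)
  -- The rows of `Q` form a basis of `V`, so those of `B * Q` are vectors of `V`. Normalizing `B`
  -- gives a compact convex set of Gram matrices for the duality; independence of the basis allows
  -- rescaling to total norm 1 afterwards.
  suffices hsuff : ∃ B : Matrix (Fin d) (Fin d) ℝ, ∑ k, ∑ l, B k l ^ 2 = 1 ∧
      ∀ b : ι → ℝ, η * ∑ k, (∑ i, b i * (B * Q) k i) ^ 2 ≤
        ∑ k, ∑ i, b i ^ 2 * (B * Q) k i ^ 2 by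
    obtain ⟨B, hB, hb⟩ := hsuff
    have hrow : ∀ k, (B * Q) k = ((∑ l, B k l • e l : V) : ι → ℝ) := by
      intro k
      ext i
      rw [Matrix.mul_apply]
      simp [Q]
    set s := ∑ k, ∑ i, (B * Q) k i ^ 2 with hs
    have hs0 : 0 ≤ s := sum_nonneg fun _ _ => sum_nonneg fun _ _ => sq_nonneg _
    have hspos : 0 < s := by
      rcases hs0.lt_or_eq with h | h
      · exact h
      exfalso
      have hz : ∀ k, (B * Q) k = 0 := by
        intro k
        have h1 := (sum_eq_zero_iff_of_nonneg
          (fun _ _ => sum_nonneg fun _ _ => sq_nonneg _)).1 h.symm k (mem_univ k)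
        ext i
        exact pow_eq_zero_iff (two_ne_zero) |>.1
          ((sum_eq_zero_iff_of_nonneg (fun _ _ => sq_nonneg _)).1 h1 i (mem_univ i))
      have hB0 : ∀ k l, B k l = 0 := by
        intro k
        have h2 : (∑ l, B k l • e l : V) = 0 := by
          apply Subtype.ext
          rw [← hrow, hz]; rfl
        exact Fintype.linearIndependent_iff.1 e.linearIndependent _ h2
      simp [hB0] at hB
    refine ⟨fun k i => (√s)⁻¹ * (B * Q) k i, fun k => ?_, ?_, fun b => ?_⟩
    · have : (fun i => (√s)⁻¹ * (B * Q) k i) = (√s)⁻¹ • ((∑ l, B k l • e l : V) : ι → ℝ) := by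
        rw [← hrow]; rfl
      beta_reduce
      rw [this]
      exact V.smul_mem _ (Subtype.mem _)
    · simp only [mul_pow, ← mul_sum, inv_pow, Real.sq_sqrt hs0]
      exact inv_mul_cancel₀ hspos.ne'
    · have h1 := hb b
      have h2 : ∀ k, ∑ i, b i * ((√s)⁻¹ * (B * Q) k i) = (√s)⁻¹ * ∑ i, b i * (B * Q) k i := by
        intro k; rw [mul_sum]; exact sum_congr rfl fun i _ => by ring
      simp only [h2, mul_pow, ← mul_sum, inv_pow, Real.sq_sqrt hs0]
      rw [mul_left_comm]
      refine (mul_le_mul_of_nonneg_left h1 (inv_nonneg.2 hs0)).trans_eq ?_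
      rw [mul_sum]
      exact sum_congr rfl fun k _ => by
        rw [mul_sum]; exact sum_congr rfl fun i _ => by ring
  by_contra hcon
  let K : Set (Matrix (Fin d) (Fin d) ℝ) := {M | ∃ B : Matrix (Fin d) (Fin d) ℝ,
    ∑ k, ∑ l, B k l ^ 2 = 1 ∧ M = B.transpose * B}
  let L : Matrix (Fin d) (Fin d) ℝ →ₗ[ℝ] (ι → ι → ℝ) :=
    { toFun := fun M i j => (if i = j then (Q.transpose * M * Q) i j else 0)
        - η * (Q.transpose * M * Q) i j
      map_add' := fun M N => by
        ext i j
        simp only [Matrix.mul_add, Matrix.add_mul, Matrix.add_apply, Pi.add_apply]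
        split_ifs <;> ring
      map_smul' := fun a M => by
        ext i j
        simp only [Matrix.mul_smul, Matrix.smul_mul, Matrix.smul_apply, Pi.smul_apply,
          smul_eq_mul, RingHom.id_apply]
        split_ifs <;> ring }
  have hLc : Continuous L := L.continuous_of_finiteDimensional
  let C : Set (ι → ι → ℝ) := {M | ∀ b : ι → ℝ, 0 ≤ ∑ i, ∑ j, b i * b j * M i j}
  have hCconv : Convex ℝ C := by
    intro M hM N hN a b ha hb _ x
    have : ∑ i, ∑ j, x i * x j * (a • M + b • N) i j =
        a * (∑ i, ∑ j, x i * x j * M i j) + b * ∑ i, ∑ j, x i * x j * N i j := by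
      simp only [mul_sum, ← sum_add_distrib]
      refine sum_congr rfl fun i _ => sum_congr rfl fun j _ => ?_
      simp only [Pi.add_apply, Pi.smul_apply, smul_eq_mul]; ring
    rw [this]
    exact add_nonneg (mul_nonneg ha (hM x)) (mul_nonneg hb (hN x))
  have hCcl : IsClosed C := by
    simp only [C, Set.ofPred_forall]
    exact isClosed_iInter fun b => isClosed_le continuous_const (by fun_prop)
  have hquad : ∀ (B : Matrix (Fin d) (Fin d) ℝ) (i j : ι),
      (Q.transpose * (B.transpose * B) * Q) i j = ∑ k, (B * Q) k i * (B * Q) k j := by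
    intro B i j
    rw [← Matrix.mul_assoc, Matrix.mul_assoc, ← Matrix.transpose_mul, Matrix.mul_apply]
    rfl
  have hdisj : Disjoint (L '' K) C := by
    rw [Set.disjoint_left]
    rintro _ ⟨_, ⟨B, hB, rfl⟩, rfl⟩ hmem
    refine hcon ⟨B, hB, fun b => ?_⟩
    have h0 : 0 ≤ ∑ i, ∑ j, b i * b j * ((if i = j then
        (Q.transpose * (B.transpose * B) * Q) i j else 0)
        - η * (Q.transpose * (B.transpose * B) * Q) i j) := hmem b
    have h1 : ∑ i, ∑ j, b i * b j * ((if i = j then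
        (Q.transpose * (B.transpose * B) * Q) i j else 0)
        - η * (Q.transpose * (B.transpose * B) * Q) i j) =
        ∑ k, ∑ i, b i ^ 2 * (B * Q) k i ^ 2 - η * ∑ k, (∑ i, b i * (B * Q) k i) ^ 2 := by
      simp only [mul_sub, sum_sub_distrib, mul_ite, mul_zero, sum_ite_eq, mem_univ, if_true, hquad]
      congr 1
      · rw [sum_comm]
        refine sum_congr rfl fun i _ => ?_
        rw [mul_sum]
        exact sum_congr rfl fun k _ => by ring
      · simp only [pow_two, sum_mul_sum]
        rw [mul_sum]
        simp only [mul_sum]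
        symm
        rw [sum_comm]
        refine sum_congr rfl fun i _ => ?_
        rw [sum_comm]
        exact sum_congr rfl fun j _ => sum_congr rfl fun k _ => by ring
    linarith
  -- If no covariance works, the image of the trace-one Gram matrices under diag − η·id misses the
  -- cone of nonnegative forms. The separating functional is nonnegative on the cone and plays the
  -- role of the quadratic form in the trace bound.
  obtain ⟨f, u, w, hfu, huw, hwf⟩ := geometric_hahn_banach_compact_closed
    ((convex_gram_sphere (Fin d)).linear_image L)
    ((isCompact_gram_sphere (Fin d)).image hLc) hCconv hCcl hdisj
  have hw0 : w < 0 := by simpa using hwf 0 (fun b => by simp)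
  have hu0 : u < 0 := huw.trans hw0
  have hf0 : ∀ M ∈ C, 0 ≤ f M := by
    intro M hM
    by_contra hneg
    push Not at hneg
    have hmem : (w / f M) • M ∈ C := by
      intro b
      have h1 : ∑ i, ∑ j, b i * b j * ((w / f M) • M) i j =
          (w / f M) * ∑ i, ∑ j, b i * b j * M i j := by
        simp only [mul_sum, Pi.smul_apply, smul_eq_mul]
        exact sum_congr rfl fun i _ => sum_congr rfl fun j _ => by ring
      rw [h1]
      exact mul_nonneg (div_nonneg_of_nonpos hw0.le hneg.le) (hM b)
    have h2 := hwf _ hmem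
    rw [map_smul, smul_eq_mul, div_mul_cancel₀ _ hneg.ne] at h2
    exact lt_irrefl _ h2
  let G : Matrix ι ι ℝ := fun i j => f (Pi.single i (Pi.single j 1))
  have hfG : ∀ M : ι → ι → ℝ, f M = ∑ i, ∑ j, M i j * G i j := by
    intro M
    have hM : M = ∑ i, ∑ j, M i j • (Pi.single i (Pi.single j (1 : ℝ)) : ι → ι → ℝ) := by
      ext i j
      simp [Finset.sum_apply, Pi.single_apply, ite_apply]
    conv_lhs => rw [hM]
    simp only [map_sum, map_smul, smul_eq_mul, G]
  set R := ∑ i, ∑ k, Q k i ^ 2 with hR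
  have hR0 : 0 ≤ R := sum_nonneg fun _ _ => sum_nonneg fun _ _ => sq_nonneg _
  -- The strict gap `u < 0` leaves room to add `ε` times the identity, which makes all diagonal
  -- entries positive as the trace bound requires.
  set ε := -u / (R + 1) with hε
  have hε0 : 0 < ε := div_pos (by linarith) (by linarith)
  have hεR : ε * R < -u := by
    have : ε * (R + 1) = -u := div_mul_cancel₀ _ (by linarith)
    linarith
  let A : Matrix ι ι ℝ := (1 / 2 : ℝ) • (G + G.transpose) + ε • 1
  have hquadA : ∀ x : ι → ℝ, x ⬝ᵥ A.mulVec x = f (fun i j => x i * x j) + ε * ∑ i, x i ^ 2 := by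
    intro x
    have hsw : ∑ i, ∑ j, x i * x j * G j i = ∑ i, ∑ j, x i * x j * G i j := by
      rw [sum_comm]
      exact sum_congr rfl fun i _ => sum_congr rfl fun j _ => by ring
    have h1 : x ⬝ᵥ A.mulVec x = (1 / 2) * (∑ i, ∑ j, x i * x j * G i j) +
        (1 / 2) * (∑ i, ∑ j, x i * x j * G j i) + ε * ∑ i, x i ^ 2 := by
      simp only [A, Matrix.add_mulVec, Matrix.smul_mulVec, Matrix.one_mulVec, dotProduct_add,
        dotProduct_smul, smul_eq_mul]
      simp only [dotProduct, Matrix.mulVec, Matrix.transpose_apply, mul_sum, ← sum_add_distrib]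
      refine sum_congr rfl fun i _ => ?_
      congr 1
      · exact sum_congr rfl fun j _ => by ring
      · ring
    rw [h1, hsw, hfG]
    ring
  have hA : A.PosSemidef := by
    refine .of_dotProduct_mulVec_nonneg ?_ fun x => ?_
    · ext i j
      simp [A, Matrix.one_apply, eq_comm, add_comm]
    · rw [star_trivial, hquadA]
      refine add_nonneg (hf0 _ fun b => ?_) (mul_nonneg hε0.le (sum_nonneg fun _ _ => sq_nonneg _))
      have : ∑ i, ∑ j, b i * b j * (x i * x j) = (∑ i, b i * x i) ^ 2 := by
        rw [pow_two, sum_mul_sum]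
        exact sum_congr rfl fun i _ => sum_congr rfl fun j _ => by ring
      rw [this]
      exact sq_nonneg _
  obtain ⟨B, hB⟩ := hA.exists_transpose_mul_self
  have hquadB : ∀ x : ι → ℝ, x ⬝ᵥ A.mulVec x = ∑ l, (∑ i, B l i * x i) ^ 2 := by
    intro x
    rw [hB, ← Matrix.mulVec_mulVec, Matrix.dotProduct_mulVec, Matrix.vecMul_transpose]
    simp only [dotProduct, Matrix.mulVec, pow_two]
  have hdiag : ∀ i, ∑ l, B l i ^ 2 = G i i + ε := by
    intro i
    have h1 : A i i = ∑ l, B l i ^ 2 := by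
      rw [hB, Matrix.mul_apply]
      exact sum_congr rfl fun l _ => by rw [Matrix.transpose_apply, pow_two]
    rw [← h1]
    simp only [A, Matrix.add_apply, Matrix.smul_apply, Matrix.transpose_apply,
      Matrix.one_apply_eq, smul_eq_mul]
    ring
  have hGnn : ∀ i, 0 ≤ G i i := by
    intro i
    refine hf0 _ fun b => ?_
    have : ∑ k, ∑ j, b k * b j * (Pi.single i (Pi.single i (1 : ℝ)) : ι → ι → ℝ) k j =
        b i * b i := by
      simp [Pi.single_apply, ite_apply]
    rw [this]
    exact mul_self_nonneg _
  refine absurd (finrank_lt_of_diagonal_lt V hV η B (fun i => ?_) fun v hv hv0 => ?_)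
    (not_lt.2 hdim)
  · rw [hdiag]; linarith [hGnn i]
  · let z : Fin d → ℝ := fun k => e.repr ⟨v, hv⟩ k
    have hvz : ∀ i, v i = ∑ k, z k * Q k i := by
      intro i
      have h1 := congrArg (fun y : V => (y : ι → ℝ) i) (e.sum_repr ⟨v, hv⟩)
      simp only [Submodule.coe_sum, Submodule.coe_smul, Finset.sum_apply, Pi.smul_apply,
        smul_eq_mul] at h1
      exact h1.symm
    set r := ∑ k, z k ^ 2 with hr
    have hr0 : 0 ≤ r := sum_nonneg fun _ _ => sq_nonneg _
    have hvr : ∑ i, v i ^ 2 ≤ r * R := by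
      rw [hR, mul_sum]
      refine sum_le_sum fun i _ => ?_
      rw [hvz]
      exact sum_mul_sq_le_sq_mul_sq _ _ _
    have hrpos : 0 < r := by
      rcases hr0.lt_or_eq with h | h
      · exact h
      exfalso
      apply hv0
      ext i
      rw [hvz]
      refine sum_eq_zero fun k _ => ?_
      have := (sum_eq_zero_iff_of_nonneg (fun _ _ => sq_nonneg _)).1 h.symm k (mem_univ k)
      rw [pow_eq_zero_iff two_ne_zero |>.1 this, zero_mul]
    let k₀ : Fin d := ⟨0, hV⟩
    -- A single nonzero row produces the rank-one covariance of `v`, so separation becomes the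
    -- inequality of the trace bound at `v`.
    let Z : Matrix (Fin d) (Fin d) ℝ := fun k l => if k = k₀ then z l / √r else 0
    have hZ : ∑ k, ∑ l, Z k l ^ 2 = 1 := by
      simp only [Z, ite_pow, div_pow, Real.sq_sqrt hr0]
      rw [sum_eq_single k₀ (by intro k _ hk; simp [hk]) (by simp)]
      simp only [if_true, ← sum_div]
      exact div_self hrpos.ne'
    have hZQ : ∀ i j, ∑ k, (Z * Q) k i * (Z * Q) k j = v i * v j / r := by
      intro i j
      have hk : ∀ i, (Z * Q) k₀ i = v i / √r := by
        intro i
        rw [Matrix.mul_apply, hvz, sum_div]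
        refine sum_congr rfl fun l _ => ?_
        simp only [Z, if_true]; ring
      rw [sum_eq_single k₀ (by
          intro k _ hk; rw [Matrix.mul_apply]; simp [Z, hk]) (by simp), hk, hk,
        div_mul_div_comm, Real.mul_self_sqrt hr0]
    have h1 := hfu _ ⟨_, ⟨Z, hZ, rfl⟩, rfl⟩
    have h2 : f (L (Z.transpose * Z)) =
        ((∑ i, G i i * v i ^ 2) - η * f (fun i j => v i * v j)) / r := by
      rw [hfG, hfG]
      have : ∀ i j, L (Z.transpose * Z) i j =
          (if i = j then v i * v j / r else 0) - η * (v i * v j / r) := by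
        intro i j
        rw [← hZQ, ← hquad]; rfl
      simp only [this, sub_mul, sum_sub_distrib, ite_mul, zero_mul, sum_ite_eq, mem_univ, if_true,
        sub_div, sum_div, mul_sum]
      congr 1
      · exact sum_congr rfl fun i _ => by ring
      · exact sum_congr rfl fun i _ => sum_congr rfl fun j _ => by ring
    rw [h2, div_lt_iff₀ hrpos] at h1
    have h3 := hquadA v
    rw [hquadB] at h3
    rw [h3]
    simp only [hdiag, add_mul, sum_add_distrib, ← mul_sum]
    have h4 : 0 ≤ ∑ i, v i ^ 2 := sum_nonneg fun _ _ => sq_nonneg _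
    have h5 := mul_le_mul_of_nonneg_left hvr hε0.le
    have h6 := mul_lt_mul_of_pos_right hεR hrpos
    have h7 : 0 ≤ η * (ε * ∑ i, v i ^ 2) := by positivity
    nlinarith

/-! ### Exponential potential under a balanced step -/

/-- The exponential potential `exp (⟨a, y⟩ + c ∑ a_i² (y_i - y_i²))` of a fractional point. -/
noncomputable def expPotential {ι : Type} [Fintype ι] (c : ℝ) (a y : ι → ℝ) : ℝ :=
  Real.exp (∑ i, a i * y i + c * ∑ i, a i ^ 2 * (y i - y i ^ 2))

theorem expPotential_add_smul {ι : Type} [Fintype ι] (c : ℝ) (a y v : ι → ℝ) (s : ℝ) :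
    expPotential c a (y + s • v) = expPotential c a y *
      Real.exp (s * (∑ i, (a i + c * a i ^ 2 * (1 - 2 * y i)) * v i)
        - c * s ^ 2 * ∑ i, a i ^ 2 * v i ^ 2) := by
  rw [expPotential, expPotential, ← Real.exp_add]
  congr 1
  simp only [mul_sum, ← sum_add_distrib, ← sum_sub_distrib, Pi.add_apply, Pi.smul_apply,
    smul_eq_mul]
  exact sum_congr rfl fun i _ => by ring

theorem exp_le_one_add_add_sq {x : ℝ} (hx : |x| ≤ 1) : Real.exp x ≤ 1 + x + x ^ 2 := by
  have := (abs_le.1 (Real.abs_exp_sub_one_sub_id_le hx)).2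
  linarith

/-- One symmetric step along a balanced family does not increase the average potential. -/
theorem sum_expPotential_step_le {ι K : Type} [Fintype ι] [Fintype K] {η : ℝ} (hη : 0 < η)
    (hη1 : η ≤ 1) (v : K → ι → ℝ) (hv1 : ∑ k, ∑ i, v k i ^ 2 = 1)
    (hv : ∀ b : ι → ℝ, η * ∑ k, (∑ i, b i * v k i) ^ 2 ≤ ∑ k, ∑ i, b i ^ 2 * v k i ^ 2)
    {y : ι → ℝ} (hy : ∀ i, y i ∈ Set.Icc (0 : ℝ) 1) {a : ι → ℝ} (ha : ∀ i, |a i| ≤ η / 4)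
    {s : ℝ} (hs : s ^ 2 * (3 * (Fintype.card ι + 1)) ≤ 1) :
    ∑ k, (expPotential (4 / η) a (y + s • v k) + expPotential (4 / η) a (y - s • v k)) ≤
      2 * Fintype.card K * expPotential (4 / η) a y := by
  set c := 4 / η with hc
  have hc0 : 0 < c := by positivity
  set b : ι → ℝ := fun i => a i + c * a i ^ 2 * (1 - 2 * y i) with hb
  set u : K → ℝ := fun k => ∑ i, b i * v k i with hu
  set q : K → ℝ := fun k => ∑ i, a i ^ 2 * v k i ^ 2 with hq
  set n : ℝ := (Fintype.card ι : ℝ) with hn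
  have hn0 : 0 ≤ n := Nat.cast_nonneg _
  have hcη : c * η = 4 := by rw [hc]; field_simp
  have hq0 : ∀ k, 0 ≤ q k := fun k => sum_nonneg fun i _ => by positivity
  have ha2 : ∀ i, a i ^ 2 ≤ η ^ 2 / 16 := by
    intro i
    have := pow_le_pow_left₀ (abs_nonneg _) (ha i) 2
    rw [sq_abs] at this
    linarith
  -- The smallness `|a i| ≤ η / 4` gives `c * |a i| ≤ 1`, so the gradient of the energy at most
  -- doubles `a i`.
  have hb2 : ∀ i, b i ^ 2 ≤ 4 * a i ^ 2 := by
    intro i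
    have h1 : |c * a i * (1 - 2 * y i)| ≤ 1 := by
      rw [abs_mul, abs_mul, abs_of_pos hc0]
      have h2 : c * |a i| ≤ 1 := by
        have := mul_le_mul_of_nonneg_left (ha i) hc0.le
        linarith
      have h3 : |1 - 2 * y i| ≤ 1 := by
        rw [abs_le]; constructor <;> linarith [(hy i).1, (hy i).2]
      exact mul_le_one₀ h2 (abs_nonneg _) h3
    have h4 : b i = a i * (1 + c * a i * (1 - 2 * y i)) := by simp only [hb]; ring
    have h5 := abs_le.1 h1
    rw [h4, mul_pow, mul_comm]
    refine mul_le_mul_of_nonneg_right ?_ (sq_nonneg _)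
    nlinarith
  have hvk : ∀ k, ∑ i, v k i ^ 2 ≤ 1 := fun k => hv1 ▸
    single_le_sum (f := fun k => ∑ i, v k i ^ 2)
      (fun _ _ => sum_nonneg fun _ _ => sq_nonneg _) (mem_univ k)
  have hqk : ∀ k, q k ≤ η ^ 2 / 16 := by
    intro k
    calc q k ≤ ∑ i, η ^ 2 / 16 * v k i ^ 2 :=
          sum_le_sum fun i _ => mul_le_mul_of_nonneg_right (ha2 i) (sq_nonneg _)
      _ = η ^ 2 / 16 * ∑ i, v k i ^ 2 := by rw [mul_sum]
      _ ≤ _ := by nlinarith [hvk k, sq_nonneg η]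
  have huk : ∀ k, u k ^ 2 ≤ n * (η ^ 2 / 4) := by
    intro k
    have h0 : ∑ i, b i ^ 2 ≤ n * (η ^ 2 / 4) := by
      calc ∑ i, b i ^ 2 ≤ ∑ _i : ι, η ^ 2 / 4 :=
            sum_le_sum fun i _ => (hb2 i).trans (by linarith [ha2 i])
        _ = _ := by simp [hn]
    have h00 : 0 ≤ n * (η ^ 2 / 4) := by positivity
    calc u k ^ 2 ≤ (∑ i, b i ^ 2) * ∑ i, v k i ^ 2 := sum_mul_sq_le_sq_mul_sq _ _ _
      _ ≤ (n * (η ^ 2 / 4)) * 1 := mul_le_mul h0 (hvk k)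
          (sum_nonneg fun _ _ => sq_nonneg _) h00
      _ = _ := mul_one _
  have hsumu : η * ∑ k, u k ^ 2 ≤ 4 * ∑ k, q k := by
    refine (hv b).trans ?_
    rw [mul_sum]
    refine sum_le_sum fun k _ => ?_
    rw [hq, mul_sum]
    refine sum_le_sum fun i _ => ?_
    rw [← mul_assoc]
    exact mul_le_mul_of_nonneg_right (hb2 i) (sq_nonneg _)
  -- `W k` bounds the log-change of the symmetrized potential, via cosh x ≤ exp(x²/2). A single `W
  -- k` may be positive; only the sum over `k` is controlled. Since `T k ≤ 1 / 3`, the quadratic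
  -- error is at most `T k / 3`, and then `W k + T k / 3` is a multiple of `u k ^ 2 - c * q k`,
  -- whose sum is nonpositive exactly when c = 4/η suffices for `hsumu`.
  set W : K → ℝ := fun k => s ^ 2 * (u k ^ 2 / 2 - c * q k) with hW
  set T : K → ℝ := fun k => s ^ 2 * (u k ^ 2 / 2 + c * q k) with hT
  have hs0 : 0 ≤ s ^ 2 := sq_nonneg s
  have hT0 : ∀ k, 0 ≤ T k := fun k =>
    mul_nonneg hs0 (add_nonneg (by positivity) (mul_nonneg hc0.le (hq0 k)))
  have hT1 : ∀ k, T k ≤ 1 / 3 := by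
    intro k
    have h1 : c * q k ≤ 1 := by
      have := mul_le_mul_of_nonneg_left (hqk k) hc0.le
      have h2 : c * (η ^ 2 / 16) = η / 4 := by
        rw [pow_two, mul_div_assoc', ← mul_assoc, hcη]; ring
      linarith
    have h2 : u k ^ 2 / 2 ≤ n := by
      have : n * (η ^ 2 / 4) ≤ n * 1 := mul_le_mul_of_nonneg_left (by nlinarith) hn0
      linarith [huk k]
    have h3 : T k ≤ s ^ 2 * (n + 1) := mul_le_mul_of_nonneg_left (by linarith) hs0
    linarith
  have hWT : ∀ k, |W k| ≤ T k := by
    intro k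
    have := mul_nonneg hs0 (mul_nonneg hc0.le (hq0 k))
    have := mul_nonneg hs0 (sq_nonneg (u k))
    simp only [hW, hT]
    rw [abs_le]; constructor <;> nlinarith
  have hexpW : ∀ k, Real.exp (W k) ≤ 1 + W k + T k / 3 := by
    intro k
    refine (exp_le_one_add_add_sq ((hWT k).trans ((hT1 k).trans (by norm_num)))).trans ?_
    have h1 : W k ^ 2 ≤ T k ^ 2 := by
      rw [← sq_abs]; exact pow_le_pow_left₀ (abs_nonneg _) (hWT k) 2
    nlinarith [hT0 k, hT1 k]
  have hsumW : ∑ k, (W k + T k / 3) ≤ 0 := by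
    have h1 : ∑ k, (W k + T k / 3) =
        s ^ 2 * ((2 / 3) * ∑ k, u k ^ 2 - (2 / 3) * c * ∑ k, q k) := by
      rw [mul_sum, mul_sum, ← sum_sub_distrib, mul_sum]
      exact sum_congr rfl fun k _ => by simp only [hW, hT]; ring
    have h2 : ∑ k, u k ^ 2 ≤ c * ∑ k, q k := by
      rw [hc, div_mul_eq_mul_div, le_div_iff₀ hη]
      linarith
    rw [h1]
    exact mul_nonpos_of_nonneg_of_nonpos hs0 (by linarith)
  have hpair : ∀ k, expPotential c a (y + s • v k) + expPotential c a (y - s • v k) ≤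
      2 * expPotential c a y * Real.exp (W k) := by
    intro k
    have hneg : y - s • v k = y + (-s) • v k := by rw [neg_smul, sub_eq_add_neg]
    rw [hneg, expPotential_add_smul, expPotential_add_smul]
    have h1 : Real.exp (s * u k - c * s ^ 2 * q k) + Real.exp (-s * u k - c * (-s) ^ 2 * q k) =
        2 * (Real.cosh (s * u k) * Real.exp (-(c * s ^ 2 * q k))) := by
      rw [Real.cosh_eq, sub_eq_add_neg, Real.exp_add, neg_sq, sub_eq_add_neg, Real.exp_add,
        neg_mul]
      ring
    have h2 : Real.cosh (s * u k) * Real.exp (-(c * s ^ 2 * q k)) ≤ Real.exp (W k) := by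
      calc _ ≤ Real.exp ((s * u k) ^ 2 / 2) * Real.exp (-(c * s ^ 2 * q k)) :=
            mul_le_mul_of_nonneg_right (Real.cosh_le_exp_half_sq _) (Real.exp_pos _).le
        _ = _ := by rw [← Real.exp_add]; congr 1; simp only [hW]; ring
    calc _ = expPotential c a y * (Real.exp (s * u k - c * s ^ 2 * q k) +
          Real.exp (-s * u k - c * (-s) ^ 2 * q k)) := by ring
      _ ≤ _ := by
        rw [h1]
        have : 0 ≤ expPotential c a y := (Real.exp_pos _).le
        nlinarith
  have hpos : 0 ≤ expPotential c a y := (Real.exp_pos _).le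
  calc _ ≤ ∑ k, 2 * expPotential c a y * (1 + W k + T k / 3) := sum_le_sum fun k _ =>
        (hpair k).trans (mul_le_mul_of_nonneg_left (hexpW k) (by positivity))
    _ = 2 * expPotential c a y * (Fintype.card K + ∑ k, (W k + T k / 3)) := by
        rw [← mul_sum]
        congr 1
        simp only [add_assoc, sum_add_distrib]
        simp
    _ ≤ 2 * expPotential c a y * Fintype.card K :=
        mul_le_mul_of_nonneg_left (by linarith) (by positivity)
    _ = _ := by ring

/-! ### Step length and progress of the walk -/

open Classical in
/-- The coordinates of `y` that are already rounded. -/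
noncomputable def frozen {ι : Type} [Fintype ι] (y : ι → ℝ) : Finset ι :=
  univ.filter fun i => y i = 0 ∨ y i = 1

theorem mem_frozen {ι : Type} [Fintype ι] {y : ι → ℝ} {i : ι} :
    i ∈ frozen y ↔ y i = 0 ∨ y i = 1 := by
  simp [frozen]

/-- Progress measure of the rounding walk: freezing a coordinate outweighs any change of the
squared norm. -/
noncomputable def progress {ι : Type} [Fintype ι] (y : ι → ℝ) : ℝ :=
  (Fintype.card ι + 1) * (frozen y).card + ∑ i, y i ^ 2

theorem sum_sq_le_card {ι : Type} [Fintype ι] {y : ι → ℝ}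
    (hy : ∀ i, y i ∈ Set.Icc (0 : ℝ) 1) : ∑ i, y i ^ 2 ≤ Fintype.card ι := by
  calc ∑ i, y i ^ 2 ≤ ∑ _i : ι, (1 : ℝ) := sum_le_sum fun i _ => by
        nlinarith [(hy i).1, (hy i).2]
    _ = _ := by simp

theorem progress_add_le_of_card_lt {ι : Type} [Fintype ι] {y z : ι → ℝ}
    (hy : ∀ i, y i ∈ Set.Icc (0 : ℝ) 1) (h : (frozen y).card < (frozen z).card) :
    progress y + 1 ≤ progress z := by
  have h1 := sum_sq_le_card hy
  have h2 : 0 ≤ ∑ i, z i ^ 2 := sum_nonneg fun _ _ => sq_nonneg _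
  have h3 : ((frozen y).card : ℝ) + 1 ≤ (frozen z).card := by exact_mod_cast h
  have h4 : (0 : ℝ) ≤ Fintype.card ι := Nat.cast_nonneg _
  unfold progress
  nlinarith

/-- The step is `γ` or, if smaller, the largest one that keeps all moves in the cube. A full step
raises the squared norm in one of two opposite moves, by the parallelogram identity for a `k` of at
least average norm; a shortened step freezes a new coordinate. -/
theorem exists_step {ι K : Type} [Fintype ι] [Fintype K] {y : ι → ℝ}
    (hy : ∀ i, y i ∈ Set.Icc (0 : ℝ) 1) (v : K → ι → ℝ)
    (hfix : ∀ k, ∀ i ∈ frozen y, v k i = 0) (hv1 : ∑ k, ∑ i, v k i ^ 2 = 1)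
    (hK : Fintype.card K ≤ Fintype.card ι) {γ : ℝ} (hγ : 0 < γ) :
    ∃ s, 0 < s ∧ s ≤ γ ∧
      (∀ k i, y i + s * v k i ∈ Set.Icc (0 : ℝ) 1 ∧ y i - s * v k i ∈ Set.Icc (0 : ℝ) 1) ∧
      ∃ k, progress y + min 1 (γ ^ 2 / Fintype.card ι) ≤ progress (y + s • v k) ∨
        progress y + min 1 (γ ^ 2 / Fintype.card ι) ≤ progress (y - s • v k) := by
  classical
  have hmono : ∀ (s : ℝ) k, frozen y ⊆ frozen (y + s • v k) := by
    intro s k i hi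
    have := hfix k i hi
    rw [mem_frozen] at hi ⊢
    simpa [this] using hi
  have hneg : ∀ (s : ℝ) k, y - s • v k = y + (-s) • v k := fun s k => by
    rw [neg_smul, sub_eq_add_neg]
  set P : Finset (K × ι) := univ.filter fun e => v e.1 e.2 ≠ 0 with hP
  have hPne : P.Nonempty := by
    by_contra hne
    rw [not_nonempty_iff_eq_empty] at hne
    have : ∀ k i, v k i = 0 := by
      intro k i
      by_contra h
      have : (k, i) ∈ P := by simp [hP, h]
      simp [hne] at this
    simp [this] at hv1
  obtain ⟨⟨k₀, i₀⟩, he, hmin⟩ := P.exists_min_image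
    (fun e => min (y e.2) (1 - y e.2) / |v e.1 e.2|) hPne
  simp only [hP, mem_filter, mem_univ, true_and, Prod.forall] at he hmin
  set ρ := min (y i₀) (1 - y i₀) / |v k₀ i₀| with hρ
  have hv0 : 0 < |v k₀ i₀| := abs_pos.2 he
  have hfr : i₀ ∉ frozen y := fun h => he (hfix k₀ i₀ h)
  have hfr' := hfr
  rw [mem_frozen, not_or] at hfr'
  have hy0 : 0 < y i₀ := lt_of_le_of_ne (hy i₀).1 (Ne.symm hfr'.1)
  have hy1 : y i₀ < 1 := lt_of_le_of_ne (hy i₀).2 hfr'.2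
  have hρ0 : 0 < ρ := div_pos (lt_min hy0 (by linarith)) hv0
  have hbound : ∀ s, 0 < s → s ≤ ρ → ∀ k i, |s * v k i| ≤ min (y i) (1 - y i) := by
    intro s hs hsρ k i
    by_cases hvi : v k i = 0
    · rw [hvi, mul_zero, abs_zero]
      exact le_min (hy i).1 (by linarith [(hy i).2])
    · rw [abs_mul, abs_of_pos hs, ← le_div_iff₀ (abs_pos.2 hvi)]
      exact hsρ.trans (hmin k i hvi)
  have hspos : 0 < min γ ρ := lt_min hγ hρ0
  refine ⟨min γ ρ, hspos, min_le_left _ _, fun k i => ?_, ?_⟩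
  · have h1 := abs_le.1 (hbound _ hspos (min_le_right _ _) k i)
    have h2 := min_le_left (y i) (1 - y i)
    have h3 := min_le_right (y i) (1 - y i)
    exact ⟨⟨by linarith, by linarith⟩, ⟨by linarith, by linarith⟩⟩
  rcases le_total γ ρ with hle | hle
  · rw [min_eq_left hle]
    have hcard : (0 : ℝ) < Fintype.card ι := by
      have : Nonempty ι := ⟨i₀⟩
      exact_mod_cast Fintype.card_pos
    obtain ⟨k, -, hk⟩ : ∃ k ∈ (univ : Finset K), 1 / (Fintype.card ι : ℝ) ≤ ∑ i, v k i ^ 2 := by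
      refine exists_le_of_sum_le (s := (univ : Finset K)) ⟨k₀, mem_univ _⟩ ?_
      rw [hv1, sum_const, nsmul_eq_mul, card_univ, mul_one_div, div_le_one hcard]
      exact_mod_cast hK
    refine ⟨k, ?_⟩
    have hgain : γ ^ 2 / Fintype.card ι ≤ γ ^ 2 * ∑ i, v k i ^ 2 := by
      rw [div_eq_mul_one_div]
      exact mul_le_mul_of_nonneg_left hk (sq_nonneg _)
    have hsum : ∑ i, (y + γ • v k) i ^ 2 + ∑ i, (y - γ • v k) i ^ 2 =
        2 * ∑ i, y i ^ 2 + 2 * (γ ^ 2 * ∑ i, v k i ^ 2) := by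
      simp only [mul_sum, ← sum_add_distrib, Pi.add_apply, Pi.sub_apply, Pi.smul_apply,
        smul_eq_mul]
      exact sum_congr rfl fun i _ => by ring
    have hc : ∀ s : ℝ, ((Fintype.card ι : ℝ) + 1) * (frozen y).card ≤
        (Fintype.card ι + 1) * (frozen (y + s • v k)).card := by
      intro s
      have : ((frozen y).card : ℝ) ≤ (frozen (y + s • v k)).card := by
        exact_mod_cast card_le_card (hmono s k)
      exact mul_le_mul_of_nonneg_left this (by positivity)
    have hc1 := hc γ
    have hc2 := hc (-γ)
    rw [← hneg] at hc2
    have hm := min_le_right 1 (γ ^ 2 / (Fintype.card ι : ℝ))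
    unfold progress
    by_contra! hcon
    linarith [hcon.1, hcon.2]
  · rw [min_eq_right hle]
    have key : ∀ s : ℝ, (y i₀ + s * v k₀ i₀ = 0 ∨ y i₀ + s * v k₀ i₀ = 1) →
        progress y + min 1 (γ ^ 2 / Fintype.card ι) ≤ progress (y + s • v k₀) := by
      intro s hs
      refine le_trans (by gcongr; exact min_le_left _ _) (progress_add_le_of_card_lt hy ?_)
      refine card_lt_card ⟨hmono s k₀, fun h => hfr (h ?_)⟩
      rw [mem_frozen]; exact hs
    have hρv : ρ * |v k₀ i₀| = min (y i₀) (1 - y i₀) := div_mul_cancel₀ _ hv0.ne'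
    refine ⟨k₀, ?_⟩
    rw [hneg]
    -- The sign of the entry and the nearer of the faces 0 and 1 decide which of the two moves
    -- freezes `i₀`.
    rcases abs_cases (v k₀ i₀) with ⟨ha, -⟩ | ⟨ha, -⟩ <;> rw [ha] at hρv <;>
      rcases min_choice (y i₀) (1 - y i₀) with hm | hm <;> rw [hm] at hρv
    · exact Or.inr (key _ (Or.inl (by linarith)))
    · exact Or.inl (key _ (Or.inr (by linarith)))
    · exact Or.inl (key _ (Or.inl (by linarith)))
    · exact Or.inr (key _ (Or.inr (by linarith)))

/-! ### Partial roundings and their limit -/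

/-- The `0`-`1` vector of a set of coordinates. -/
noncomputable def indicatorVec {ι : Type} (S : Finset ι) (i : ι) : ℝ :=
  open Classical in if i ∈ S then 1 else 0

/-- A partial rounding of `y`, as weights of the `0`-`1` vectors in `𝒱`: mass at most `ε` is
missing, the mean is `y` up to `ε`, and no potential with `|a| ≤ κ` increases. -/
structure IsPartialRounding {ι : Type} [Fintype ι] (𝒱 : Set (ι → ℝ)) (c κ ε : ℝ) (y : ι → ℝ)
    (w : Finset ι → ℝ) : Prop where
  nonneg : ∀ S, 0 ≤ w S
  support : ∀ S, indicatorVec S ∉ 𝒱 → w S = 0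
  mass_le : ∑ S, w S ≤ 1
  le_mass : 1 - ε ≤ ∑ S, w S
  mean : ∀ i, |∑ S, w S * indicatorVec S i - y i| ≤ ε
  potential : ∀ a : ι → ℝ, (∀ i, |a i| ≤ κ) →
    ∑ S, w S * expPotential c a (indicatorVec S) ≤ expPotential c a y

theorem IsPartialRounding.mono {ι : Type} [Fintype ι] {𝒱 : Set (ι → ℝ)} {c κ ε ε' : ℝ}
    {y : ι → ℝ} {w : Finset ι → ℝ} (h : IsPartialRounding 𝒱 c κ ε y w) (hε : ε ≤ ε') :
    IsPartialRounding 𝒱 c κ ε' y w :=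
  { h with
    le_mass := by linarith [h.le_mass]
    mean := fun i => (h.mean i).trans hε }

theorem isPartialRounding_zero {ι : Type} [Fintype ι] {𝒱 : Set (ι → ℝ)} {c κ : ℝ} {y : ι → ℝ}
    (hy : ∀ i, y i ∈ Set.Icc (0 : ℝ) 1) : IsPartialRounding 𝒱 c κ 1 y 0 where
  nonneg _ := le_rfl
  support _ _ := rfl
  mass_le := by simp
  le_mass := by simp
  mean i := by
    simp only [Pi.zero_apply, zero_mul, sum_const_zero, zero_sub, abs_neg]
    rw [abs_of_nonneg (hy i).1]; exact (hy i).2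
  potential a _ := by
    simp only [Pi.zero_apply, zero_mul, sum_const_zero]
    exact (Real.exp_pos _).le

theorem exists_isPartialRounding_of_frozen {ι : Type} [Fintype ι] {𝒱 : Set (ι → ℝ)} {c κ : ℝ}
    {y : ι → ℝ} (hy : y ∈ 𝒱) (hfr : ∀ i, i ∈ frozen y) :
    ∃ w, IsPartialRounding 𝒱 c κ 0 y w := by
  classical
  set S₀ : Finset ι := univ.filter fun i => y i = 1 with hS
  have hind : indicatorVec S₀ = y := by
    ext i
    have := mem_frozen.1 (hfr i)
    by_cases h : y i = 1
    · simp [indicatorVec, hS, h]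
    · simp [indicatorVec, hS, this.resolve_right h]
  have hsum : ∀ f : Finset ι → ℝ, ∑ S, (Pi.single S₀ (1 : ℝ) : Finset ι → ℝ) S * f S = f S₀ := by
    intro f
    simp [Pi.single_apply]
  have hmass : ∑ S, (Pi.single S₀ (1 : ℝ) : Finset ι → ℝ) S = 1 := by
    simp
  refine ⟨Pi.single S₀ 1, ⟨fun S => ?_, fun S hSn => ?_, hmass.le, by simp [hmass], fun i => ?_,
    fun a _ => ?_⟩⟩
  · rw [Pi.single_apply]; split_ifs <;> norm_num
  · rw [Pi.single_apply, if_neg]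
    rintro rfl
    exact hSn (hind ▸ hy)
  · rw [hsum, hind]; simp
  · rw [hsum, hind]

/-- Averaging partial roundings of the neighbours of `y`. -/
theorem exists_isPartialRounding_average {ι K : Type} [Fintype ι] [Fintype K] [Nonempty K]
    {𝒱 : Set (ι → ℝ)} {c κ : ℝ} {y : ι → ℝ} (z : K → ι → ℝ) (ε : K → ℝ)
    (hmean : ∀ i, ∑ k, z k i = Fintype.card K * y i)
    (hpot : ∀ a : ι → ℝ, (∀ i, |a i| ≤ κ) →
      ∑ k, expPotential c a (z k) ≤ Fintype.card K * expPotential c a y)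
    (h : ∀ k, ∃ w, IsPartialRounding 𝒱 c κ (ε k) (z k) w) :
    ∃ w, IsPartialRounding 𝒱 c κ ((∑ k, ε k) / Fintype.card K) y w := by
  choose w hw using h
  have hN : (0 : ℝ) < Fintype.card K := by exact_mod_cast Fintype.card_pos
  have hcomm : ∀ f : Finset ι → ℝ, ∑ S, (∑ k, w k S) / Fintype.card K * f S =
      (∑ k, ∑ S, w k S * f S) / Fintype.card K := by
    intro f
    rw [sum_comm, sum_div]
    refine sum_congr rfl fun S _ => ?_
    rw [← sum_mul]; ring
  have hcomm1 : ∑ S, (∑ k, w k S) / Fintype.card K = (∑ k, ∑ S, w k S) / Fintype.card K := by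
    simpa using hcomm fun _ => 1
  refine ⟨fun S => (∑ k, w k S) / Fintype.card K, ⟨fun S => ?_, fun S hS => ?_, ?_, ?_,
    fun i => ?_, fun a ha => ?_⟩⟩
  · exact div_nonneg (sum_nonneg fun k _ => (hw k).nonneg S) hN.le
  · simp [(hw _).support S hS]
  · rw [hcomm1, div_le_one hN]
    calc _ ≤ ∑ _k : K, (1 : ℝ) := sum_le_sum fun k _ => (hw k).mass_le
      _ = _ := by simp
  · rw [hcomm1, le_div_iff₀ hN, sub_mul, div_mul_cancel₀ _ hN.ne', one_mul]
    calc (Fintype.card K : ℝ) - ∑ k, ε k = ∑ k, (1 - ε k) := by simp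
      _ ≤ _ := sum_le_sum fun k _ => (hw k).le_mass
  · rw [hcomm]
    have : (∑ k, ∑ S, w k S * indicatorVec S i) / Fintype.card K - y i =
        (∑ k, (∑ S, w k S * indicatorVec S i - z k i)) / Fintype.card K := by
      rw [sum_sub_distrib, hmean, sub_div, mul_div_cancel_left₀ _ hN.ne']
    rw [this, abs_div, abs_of_pos hN]
    refine div_le_div_of_nonneg_right ?_ hN.le
    exact (abs_sum_le_sum_abs _ _).trans (sum_le_sum fun k _ => (hw k).mean i)
  · rw [hcomm, div_le_iff₀ hN, mul_comm]
    exact (sum_le_sum fun k _ => (hw k).potential a ha).trans (hpot a ha)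

/-- Weights live in a compact cube and each condition is closed in them; support is a condition on
single weights, so `𝒱` need not be closed. -/
theorem exists_isPartialRounding_of_tendsto {ι : Type} [Fintype ι] {𝒱 : Set (ι → ℝ)} {c κ : ℝ}
    {y : ι → ℝ} (ε : ℕ → ℝ) (hε : Filter.Tendsto ε Filter.atTop (nhds 0))
    (h : ∀ n, ∃ w, IsPartialRounding 𝒱 c κ (ε n) y w) :
    ∃ w, IsPartialRounding 𝒱 c κ 0 y w := by
  choose w hw using h
  have hmem : ∀ n, w n ∈ Set.Icc (0 : Finset ι → ℝ) 1 := fun n =>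
    ⟨fun S => (hw n).nonneg S, fun S => (single_le_sum (f := fun S => w n S)
      (fun S _ => (hw n).nonneg S) (mem_univ S)).trans (hw n).mass_le⟩
  obtain ⟨w₀, -, φ, hφ, hlim⟩ := isCompact_Icc.tendsto_subseq hmem
  have hεφ := hε.comp hφ.tendsto_atTop
  have hS : ∀ S, Filter.Tendsto (fun n => w (φ n) S) Filter.atTop (nhds (w₀ S)) :=
    fun S => (tendsto_pi_nhds.1 hlim) S
  have hsum : ∀ f : Finset ι → ℝ, Filter.Tendsto (fun n => ∑ S, w (φ n) S * f S) Filter.atTop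
      (nhds (∑ S, w₀ S * f S)) := fun f =>
    tendsto_finsetSum _ fun S _ => (hS S).mul_const _
  have hmass : Filter.Tendsto (fun n => ∑ S, w (φ n) S) Filter.atTop (nhds (∑ S, w₀ S)) :=
    tendsto_finsetSum _ fun S _ => hS S
  refine ⟨w₀, ⟨fun S => ?_, fun S hSn => ?_, ?_, ?_, fun i => ?_, fun a ha => ?_⟩⟩
  · exact ge_of_tendsto' (hS S) fun n => (hw _).nonneg S
  · refine tendsto_nhds_unique (hS S) ?_
    simp only [fun n => (hw (φ n)).support S hSn]
    exact tendsto_const_nhds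
  · exact le_of_tendsto' hmass fun n => (hw _).mass_le
  · exact le_of_tendsto_of_tendsto' (hεφ.const_sub 1) hmass fun n => (hw _).le_mass
  · exact le_of_tendsto_of_tendsto' ((hsum _).sub_const _).abs hεφ fun n => (hw _).mean i
  · exact le_of_tendsto' (hsum _) fun n => (hw _).potential a ha

theorem exists_isPartialRounding_of_progress {ι : Type} [Fintype ι] {𝒱 : Set (ι → ℝ)} {c κ τ : ℝ}
    (hcube : ∀ y ∈ 𝒱, ∀ i, y i ∈ Set.Icc (0 : ℝ) 1) (hτ : 0 < τ) (N : ℕ)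
    (hstep : ∀ y ∈ 𝒱, (∃ i, i ∉ frozen y) → ∃ (K : Type) (_ : Fintype K) (z : K → ι → ℝ),
      Fintype.card K ≤ N ∧ (∀ k, z k ∈ 𝒱) ∧ (∀ i, ∑ k, z k i = Fintype.card K * y i) ∧
      (∀ a : ι → ℝ, (∀ i, |a i| ≤ κ) →
        ∑ k, expPotential c a (z k) ≤ Fintype.card K * expPotential c a y) ∧
      ∃ k, progress y + τ ≤ progress (z k))
    {y : ι → ℝ} (hy : y ∈ 𝒱) : ∃ w, IsPartialRounding 𝒱 c κ 0 y w := by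
  classical
  set B : ℝ := (Fintype.card ι + 1) * Fintype.card ι + Fintype.card ι + 1 with hB
  have hprogB : ∀ y ∈ 𝒱, progress y < B := by
    intro y hy
    have h1 := sum_sq_le_card (hcube y hy)
    have h2 : ((frozen y).card : ℝ) ≤ Fintype.card ι := by exact_mod_cast card_le_univ _
    have h3 : (0 : ℝ) ≤ Fintype.card ι := Nat.cast_nonneg _
    have h4 := mul_le_mul_of_nonneg_left h2 (show (0 : ℝ) ≤ Fintype.card ι + 1 by linarith)
    unfold progress
    linarith
  have hprog0 : ∀ y : ι → ℝ, 0 ≤ progress y := fun y =>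
    add_nonneg (by positivity) (sum_nonneg fun _ _ => sq_nonneg _)
  set p : ℝ := 1 / (N + 1) with hp
  have hp0 : 0 < p := by positivity
  have hp1 : p ≤ 1 := by
    rw [hp, div_le_one (by positivity)]
    have : (0 : ℝ) ≤ N := Nat.cast_nonneg _
    linarith
  -- Starting from error `F` everywhere, follow the progressing neighbour, whose share of the
  -- average is at least `p`. Progress is bounded by `B`, so it cannot increase by `τ` forever: the
  -- case `m = 0` is vacuous, and a frozen point has no error. Hence a fraction `p ^ m` of the error
  -- disappears.
  have hcontract : ∀ F : ℝ, 0 ≤ F → (∀ y ∈ 𝒱, ∃ w, IsPartialRounding 𝒱 c κ F y w) →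
      ∀ m : ℕ, ∀ y ∈ 𝒱, B ≤ progress y + m * τ →
        ∃ w, IsPartialRounding 𝒱 c κ ((1 - p ^ m) * F) y w := by
    intro F hF hall m
    induction m with
    | zero =>
      intro y hy hle
      have := hprogB y hy
      simp only [Nat.cast_zero, zero_mul, add_zero] at hle
      linarith
    | succ m ih =>
      intro y hy hle
      have hpm : p ^ (m + 1) ≤ 1 := pow_le_one₀ hp0.le hp1
      by_cases hfr : ∃ i, i ∉ frozen y
      · obtain ⟨K, _, z, hKN, hz, hmean, hpot, k₀, hk₀⟩ := hstep y hy hfr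
        have : Nonempty K := ⟨k₀⟩
        have hN : (0 : ℝ) < Fintype.card K := by exact_mod_cast Fintype.card_pos
        obtain ⟨w, hw⟩ := exists_isPartialRounding_average z
          (fun k => if k = k₀ then (1 - p ^ m) * F else F) hmean hpot fun k => by
            split_ifs with hk
            · subst hk
              refine ih _ (hz _) ?_
              push_cast at hle
              linarith
            · exact hall _ (hz k)
        refine ⟨w, hw.mono ?_⟩
        have hsum : ∑ k, (if k = k₀ then (1 - p ^ m) * F else F) =
            Fintype.card K * F - p ^ m * F := by
          have : ∀ k, (if k = k₀ then (1 - p ^ m) * F else F) =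
              F - if k = k₀ then p ^ m * F else 0 := by
            intro k; split_ifs <;> ring
          simp [this, sum_sub_distrib]
        rw [hsum, div_le_iff₀ hN]
        have hpN : p * Fintype.card K ≤ 1 := by
          have : (Fintype.card K : ℝ) ≤ N + 1 := by exact_mod_cast hKN.trans (Nat.le_succ N)
          calc p * Fintype.card K ≤ p * (N + 1) := mul_le_mul_of_nonneg_left this hp0.le
            _ = 1 := by rw [hp]; field_simp
        have hpF : 0 ≤ p ^ m * F := by positivity
        have := mul_le_mul_of_nonneg_left hpN hpF
        rw [pow_succ]
        linarith
      · push Not at hfr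
        obtain ⟨w, hw⟩ := exists_isPartialRounding_of_frozen (c := c) (κ := κ) hy hfr
        exact ⟨w, hw.mono (mul_nonneg (by linarith) hF)⟩
  obtain ⟨m, hm⟩ := exists_nat_ge (B / τ)
  have hmB : ∀ y : ι → ℝ, B ≤ progress y + m * τ := by
    intro y
    rw [div_le_iff₀ hτ] at hm
    linarith [hprog0 y]
  set q : ℝ := 1 - p ^ m with hq
  have hq0 : 0 ≤ q := sub_nonneg.2 (pow_le_one₀ hp0.le hp1)
  have hq1 : q < 1 := sub_lt_self _ (pow_pos hp0 m)
  have hpow : ∀ n : ℕ, ∀ y ∈ 𝒱, ∃ w, IsPartialRounding 𝒱 c κ (q ^ n) y w := by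
    intro n
    induction n with
    | zero => exact fun y hy => ⟨0, by simpa using isPartialRounding_zero (hcube y hy)⟩
    | succ n ih =>
      intro y hy
      rw [pow_succ']
      exact hcontract _ (pow_nonneg hq0 n) ih m y hy (hmB y)
  exact exists_isPartialRounding_of_tendsto _ (tendsto_pow_atTop_nhds_zero_of_lt_one hq0 hq1)
    fun n => hpow n y hy

theorem sum_eq_sum_not_frozen {ι : Type} [Fintype ι] [DecidableEq ι] {y : ι → ℝ} (f : ι → ℝ)
    (hf : ∀ i ∈ frozen y, f i = 0) : ∑ i, f i = ∑ i : {i // i ∉ frozen y}, f i := by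
  refine (Fintype.sum_subtype_add_sum_subtype (fun i => i ∈ frozen y) f).symm.trans ?_
  rw [add_eq_right]
  exact sum_eq_zero fun i _ => hf i.1 i.2

/-- Rounding along high-dimensional spaces of feasible directions. -/
theorem exists_isPartialRounding_of_finrank {ι : Type} [Fintype ι] [DecidableEq ι] {𝒱 : Set (ι → ℝ)} {η : ℝ}
    (hη : 0 < η) (hη1 : η ≤ 1) (hcube : ∀ y ∈ 𝒱, ∀ i, y i ∈ Set.Icc (0 : ℝ) 1)
    (hdir : ∀ y ∈ 𝒱, (∃ i, i ∉ frozen y) → ∃ V : Submodule ℝ ({i // i ∉ frozen y} → ℝ),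
      0 < Module.finrank ℝ V ∧ η * Fintype.card {i // i ∉ frozen y} ≤ Module.finrank ℝ V ∧
      ∀ u : ι → ℝ, (∀ i ∈ frozen y, u i = 0) → (fun i : {i // i ∉ frozen y} => u i) ∈ V →
        (∀ i, (y + u) i ∈ Set.Icc (0 : ℝ) 1) → y + u ∈ 𝒱)
    {y : ι → ℝ} (hy : y ∈ 𝒱) : ∃ w, IsPartialRounding 𝒱 (4 / η) (η / 4) 0 y w := by
  rcases isEmpty_or_nonempty ι with hι | hι
  · exact exists_isPartialRounding_of_frozen hy fun i => isEmptyElim i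
  have hcard : (0 : ℝ) < Fintype.card ι := by exact_mod_cast Fintype.card_pos
  -- As `γ ≤ 1`, a step `s ≤ γ` satisfies `s ^ 2 ≤ γ`, which is the smallness required by
  -- `sum_expPotential_step_le`.
  set γ : ℝ := 1 / (3 * (Fintype.card ι + 1)) with hγ
  have hγ0 : 0 < γ := by positivity
  have hγ1 : γ ≤ 1 := by rw [hγ, div_le_one (by positivity)]; linarith
  have hγ2 : γ * (3 * (Fintype.card ι + 1)) = 1 := by rw [hγ]; field_simp
  refine exists_isPartialRounding_of_progress (τ := min 1 (γ ^ 2 / Fintype.card ι)) hcube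
    (lt_min one_pos (by positivity)) (2 * Fintype.card ι) (fun y hy hex => ?_) hy
  obtain ⟨V, hV0, hVη, hV⟩ := hdir y hy hex
  obtain ⟨v, hvV, hv1, hvb⟩ := exists_balanced_family V hV0 hη.le hVη
  set u : Fin (Module.finrank ℝ V) → ι → ℝ :=
    fun k i => if h : i ∉ frozen y then v k ⟨i, h⟩ else 0 with hu
  have hu0 : ∀ k, ∀ i ∈ frozen y, u k i = 0 := fun k i hi => by simp [hu, hi]
  have huv : ∀ k (i : {i // i ∉ frozen y}), u k i = v k i := fun k i => by
    simp only [hu]; rw [dif_pos i.2]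
  have hu1 : ∑ k, ∑ i, u k i ^ 2 = 1 := by
    rw [← hv1]
    refine sum_congr rfl fun k _ => ?_
    rw [sum_eq_sum_not_frozen (y := y) _ fun i hi => by rw [hu0 k i hi]; ring]
    simp only [huv]
  have hub : ∀ b : ι → ℝ, η * ∑ k, (∑ i, b i * u k i) ^ 2 ≤ ∑ k, ∑ i, b i ^ 2 * u k i ^ 2 := by
    intro b
    convert hvb fun i => b i using 2
    · refine sum_congr rfl fun k _ => ?_
      rw [sum_eq_sum_not_frozen (y := y) _ fun i hi => by rw [hu0 k i hi]; ring]
      simp only [huv]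
    · rw [sum_eq_sum_not_frozen (y := y) _ fun i hi => by rw [hu0 _ i hi]; ring]
      simp only [huv]
  have hKcard : Fintype.card (Fin (Module.finrank ℝ V)) ≤ Fintype.card ι := by
    rw [Fintype.card_fin]
    refine (Submodule.finrank_le V).trans ?_
    rw [Module.finrank_fintype_fun_eq_card]
    exact Fintype.card_subtype_le _
  obtain ⟨s, hs0, hsγ, hsc, k₀, hk₀⟩ := exists_step (hcube y hy) u hu0 hu1 hKcard hγ0
  have hs2 : s ^ 2 * (3 * (Fintype.card ι + 1)) ≤ 1 := by
    have hsγ2 : s ^ 2 ≤ γ := by nlinarith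
    exact (mul_le_mul_of_nonneg_right hsγ2 (by positivity)).trans_eq hγ2
  have hmem : ∀ (t : ℝ) (k : Fin (Module.finrank ℝ V)), (∀ i, (y + t • u k) i ∈ Set.Icc (0 : ℝ) 1) → y + t • u k ∈ 𝒱 := by
    intro t k hc
    refine hV (t • u k) (fun i hi => ?_) ?_ hc
    · rw [Pi.smul_apply, hu0 k i hi, smul_zero]
    have : (fun i : {i // i ∉ frozen y} => (t • u k) i) = t • v k := by
      ext i; simp [huv]
    rw [this]
    exact V.smul_mem _ (hvV k)
  have hneg : ∀ k, y - s • u k = y + (-s) • u k := fun k => by rw [neg_smul, sub_eq_add_neg]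
  refine ⟨Fin (Module.finrank ℝ V) ⊕ Fin (Module.finrank ℝ V), inferInstance,
    Sum.elim (fun k => y + s • u k) (fun k => y - s • u k), ?_, ?_, fun i => ?_, fun a ha => ?_, ?_⟩
  · rw [Fintype.card_sum]; omega
  · rintro (k | k)
    · exact hmem s k fun i => (hsc k i).1
    · simp only [Sum.elim_inr]
      rw [hneg]
      refine hmem (-s) k fun i => ?_
      rw [← hneg]
      exact (hsc k i).2
  · rw [Fintype.sum_sum_type, ← sum_add_distrib, Fintype.card_sum]
    simp only [Sum.elim_inl, Sum.elim_inr, Pi.add_apply, Pi.sub_apply, add_add_sub_cancel,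
      sum_const, card_univ, nsmul_eq_mul]
    push_cast; ring
  · rw [Fintype.sum_sum_type, ← sum_add_distrib, Fintype.card_sum]
    refine (sum_expPotential_step_le hη hη1 u hu1 hub (hcube y hy) ha hs2).trans_eq ?_
    push_cast; ring
  · rcases hk₀ with h | h
    · exact ⟨Sum.inl k₀, h⟩
    · exact ⟨Sum.inr k₀, h⟩

/-! ### Bernstein's inequality from the potential -/

/-- The distribution on sets of coordinates with weights `w`. -/
noncomputable def weightMeasure {ι : Type} [Fintype ι] (w : Finset ι → ℝ) :
    @Measure (Finset ι) ⊤ :=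
  ∑ S, ENNReal.ofReal (w S) • @Measure.dirac _ ⊤ S

theorem integral_weightMeasure {ι : Type} [Fintype ι] {w : Finset ι → ℝ} (hw : ∀ S, 0 ≤ w S)
    (f : Finset ι → ℝ) : @integral _ ℝ _ _ ⊤ (weightMeasure w) f = ∑ S, w S * f S := by
  let _ : MeasurableSpace (Finset ι) := ⊤
  have : MeasurableSingletonClass (Finset ι) := ⟨fun _ => trivial⟩
  unfold weightMeasure
  rw [integral_finsetSum_measure]
  · refine sum_congr rfl fun S _ => ?_
    rw [integral_smul_measure, integral_dirac, ENNReal.toReal_ofReal (hw S), smul_eq_mul]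
  · intro S _
    exact (integrable_dirac (by simp)).smul_measure ENNReal.ofReal_ne_top

theorem isProbabilityMeasure_weightMeasure {ι : Type} [Fintype ι] {w : Finset ι → ℝ}
    (hw : ∀ S, 0 ≤ w S) (h1 : ∑ S, w S = 1) :
    @IsProbabilityMeasure _ ⊤ (weightMeasure w) := by
  let _ : MeasurableSpace (Finset ι) := ⊤
  constructor
  simp only [weightMeasure, Measure.coe_finsetSum, Finset.sum_apply, Measure.smul_apply,
    measure_univ, smul_eq_mul, mul_one]
  rw [← ENNReal.ofReal_sum_of_nonneg fun S _ => hw S, h1, ENNReal.ofReal_one]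

theorem ae_weightMeasure {ι : Type} [Fintype ι] {w : Finset ι → ℝ} {P : Finset ι → Prop}
    (h : ∀ S, w S ≠ 0 → P S) : ∀ᵐ S ∂(weightMeasure w), P S := by
  let _ : MeasurableSpace (Finset ι) := ⊤
  rw [ae_iff]
  simp only [weightMeasure, Measure.coe_finsetSum, Finset.sum_apply, Measure.smul_apply,
    smul_eq_mul]
  refine sum_eq_zero fun S _ => ?_
  by_cases hS : w S = 0
  · simp [hS]
  · rw [Measure.dirac_apply' S MeasurableSpace.measurableSet_top]
    simp [h S hS]

theorem isConcentrated_weightMeasure {ι : Type} [Fintype ι] {𝒱 : Set (ι → ℝ)} {η : ℝ}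
    (hη : 0 < η) (hη1 : η ≤ 1) {x : ι → ℝ} (hx : ∀ i, x i ∈ Set.Icc (0 : ℝ) 1)
    {w : Finset ι → ℝ} (hw : IsPartialRounding 𝒱 (4 / η) (η / 4) 0 x w)
    (hone : ∑ S, w S = 1) (hmean : ∀ i, ∑ S, w S * indicatorVec S i = x i) :
    @UnrelatedMachines.IsConcentrated (Finset ι) ι ⊤ _ (weightMeasure w)
      (fun i S => indicatorVec S i) x (12 / η) := by
  let _ : MeasurableSpace (Finset ι) := ⊤
  have : MeasurableSingletonClass (Finset ι) := ⟨fun _ => trivial⟩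
  have hprob : IsProbabilityMeasure (weightMeasure w) :=
    isProbabilityMeasure_weightMeasure hw.nonneg hone
  have hmeanSum : ∀ a : ι → ℝ, ∫ S, (∑ i, a i * indicatorVec S i) ∂(weightMeasure w) =
      ∑ i, a i * x i := by
    intro a
    rw [integral_weightMeasure hw.nonneg]
    simp only [mul_sum, ← hmean]
    rw [sum_comm]
    exact sum_congr rfl fun i _ => sum_congr rfl fun S _ => by ring
  refine ⟨?_, fun i => measurable_from_top, fun i => .of_forall fun S => ?_, fun i => ?_,
    fun a t ht => ?_⟩
  · rw [le_div_iff₀ hη]; linarith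
  · by_cases h : i ∈ S <;> simp [indicatorVec, h]
  · rw [integral_weightMeasure hw.nonneg, hmean]
  rw [hmeanSum]
  set M := ⨆ i, |a i| with hM
  set Φ := ∑ i, a i ^ 2 * (x i - x i ^ 2) with hΦ
  have haM : ∀ i, |a i| ≤ M := fun i => le_ciSup (Set.finite_range fun i => |a i|).bddAbove i
  have hM0 : 0 ≤ M := Real.iSup_nonneg fun i => abs_nonneg _
  have hΦ0 : 0 ≤ Φ := sum_nonneg fun i _ => mul_nonneg (sq_nonneg _)
    (by nlinarith [(hx i).1, (hx i).2])
  -- For `M = 0` the denominator `D` below would vanish, but the event is empty because `t > 0`.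
  rcases hM0.eq_or_lt with hMz | hMpos
  · have ha0 : ∀ i, a i = 0 := fun i => abs_nonpos_iff.1 (hMz ▸ haM i)
    have hempty : {S : Finset ι | t ≤ (∑ i, a i * indicatorVec S i) - ∑ i, a i * x i} = ∅ := by
      ext S
      simp [ha0, ht]
    rw [hempty, measureReal_empty]
    exact (Real.exp_pos _).le
  -- In θ = tη/D, the term 4Mt ensures θM ≤ η/4, so the potential applies, and 8Φ ensures that the
  -- variance term costs at most half of θt. The remaining exponent is t²η/(2D), and 2D = 16Φ + 8Mt
  -- ≤ 12 · 2(Φ + Mt/3); the coefficient of Mt is where 12 comes from.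
  set D := 8 * Φ + 4 * (M * t) with hD
  have hMt : 0 < M * t := mul_pos hMpos ht
  have hDpos : 0 < D := by linarith
  set θ := t * η / D with hθ
  have hθ0 : 0 ≤ θ := by positivity
  have hθD : θ * D = t * η := div_mul_cancel₀ _ hDpos.ne'
  have hθM : θ * M ≤ η / 4 := by
    rw [hθ, div_mul_eq_mul_div, div_le_iff₀ hDpos]
    nlinarith
  have hθa : ∀ i, |θ * a i| ≤ η / 4 := fun i => by
    rw [abs_mul, abs_of_nonneg hθ0]
    exact (mul_le_mul_of_nonneg_left (haM i) hθ0).trans hθM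
  have hpot := hw.potential (fun i => θ * a i) hθa
  set m₀ := ∑ i, a i * x i with hm₀
  have hexp : ∀ S : Finset ι, Real.exp (θ * ((∑ i, a i * indicatorVec S i) - m₀)) =
      Real.exp (-(θ * m₀)) * expPotential (4 / η) (fun i => θ * a i) (indicatorVec S) := by
    intro S
    rw [expPotential, ← Real.exp_add]
    congr 1
    have h1 : ∀ i, indicatorVec S i - indicatorVec S i ^ 2 = 0 := by
      intro i; by_cases h : i ∈ S <;> simp [indicatorVec, h]
    have h2 : ∑ i, θ * a i * indicatorVec S i = θ * ∑ i, a i * indicatorVec S i := by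
      rw [mul_sum]; exact sum_congr rfl fun i _ => by ring
    simp only [h1, h2, mul_zero, sum_const_zero]
    ring
  have hpx : expPotential (4 / η) (fun i => θ * a i) x = Real.exp (θ * m₀ + 4 / η * θ ^ 2 * Φ) := by
    rw [expPotential]
    congr 1
    simp only [hm₀, hΦ, mul_sum]
    congr 1
    · exact sum_congr rfl fun i _ => by ring
    · exact sum_congr rfl fun i _ => by ring
  have hmgf : ProbabilityTheory.mgf (fun S : Finset ι => (∑ i, a i * indicatorVec S i) - m₀)
      (weightMeasure w) θ ≤ Real.exp (4 / η * θ ^ 2 * Φ) := by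
    rw [ProbabilityTheory.mgf, integral_weightMeasure hw.nonneg]
    calc ∑ S, w S * Real.exp (θ * ((∑ i, a i * indicatorVec S i) - m₀)) =
          Real.exp (-(θ * m₀)) *
            ∑ S, w S * expPotential (4 / η) (fun i => θ * a i) (indicatorVec S) := by
          rw [mul_sum]
          exact sum_congr rfl fun S _ => by rw [hexp]; ring
      _ ≤ Real.exp (-(θ * m₀)) * Real.exp (θ * m₀ + 4 / η * θ ^ 2 * Φ) := by
          rw [← hpx]
          exact mul_le_mul_of_nonneg_left hpot (Real.exp_pos _).le
      _ = _ := by rw [← Real.exp_add]; congr 1; ring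
  refine (ProbabilityTheory.measure_ge_le_exp_mul_mgf t hθ0 (.of_finite)).trans ?_
  refine (mul_le_mul_of_nonneg_left hmgf (Real.exp_pos _).le).trans ?_
  rw [← Real.exp_add, Real.exp_le_exp]
  have h1 : 4 / η * θ ^ 2 * Φ ≤ θ * t / 2 := by
    have h2 : 4 / η * θ ^ 2 * Φ = θ * (4 * (θ * Φ) / η) := by ring
    have h3 : 4 * (θ * Φ) / η ≤ t / 2 := by
      rw [div_le_iff₀ hη]
      have : 0 ≤ θ * (M * t) := by positivity
      rw [hD] at hθD
      linarith
    rw [h2]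
    linarith [mul_le_mul_of_nonneg_left h3 hθ0]
  have h4 : t ^ 2 / (12 / η) / (2 * (Φ + M * t / 3)) ≤ θ * t / 2 := by
    have h5 : θ * t / 2 = t ^ 2 * η / (2 * D) := by rw [hθ]; field_simp
    have h6 : t ^ 2 / (12 / η) / (2 * (Φ + M * t / 3)) =
        t ^ 2 * η / (12 * (2 * (Φ + M * t / 3))) := by
      field_simp
    rw [h5, h6]
    refine div_le_div_of_nonneg_left (by positivity) (by positivity) ?_
    rw [hD]
    linarith
  linarith

/-! ### Feasible directions for scheduling -/

/-- The fractional assignments in which every machine either still has its initial load `L i`, or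
has total size of supported jobs at most `L i + β`. -/
def admissibleSet {m r : ℕ} (p : Fin m → Fin r → ℝ) (L : Fin m → ℝ) (β : ℝ) :
    Set (Fin m × Fin r → ℝ) :=
  {y | (∀ e, y e ∈ Set.Icc (0 : ℝ) 1) ∧ (∀ j, ∑ i, y (i, j) = 1) ∧
    ∀ i, ∑ j, p i j * y (i, j) = L i ∨ ∑ j, (if y (i, j) = 0 then 0 else p i j) ≤ L i + β}

/-- Jobs that are not yet assigned integrally. -/
noncomputable def openJobs {m r : ℕ} (y : Fin m × Fin r → ℝ) : Finset (Fin r) :=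
  univ.filter fun j => ∃ i, (i, j) ∉ frozen y

/-- Machines whose load has to be preserved. -/
noncomputable def tightMachines {m r : ℕ} (p : Fin m → Fin r → ℝ) (L : Fin m → ℝ) (β : ℝ)
    (y : Fin m × Fin r → ℝ) : Finset (Fin m) :=
  univ.filter fun i => L i + β < ∑ j, if y (i, j) = 0 then 0 else p i j

/-- The constraint matrix of the directions of movement at `y`. -/
noncomputable def constraintMatrix {m r : ℕ} (p : Fin m → Fin r → ℝ) (L : Fin m → ℝ) (β : ℝ)
    (y : Fin m × Fin r → ℝ) :
    Matrix (openJobs y ⊕ tightMachines p L β y) {e // e ∉ frozen y} ℝ :=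
  fun c e => Sum.elim (fun j : openJobs y => if (e : Fin m × Fin r).2 = j then 1 else 0)
    (fun i : tightMachines p L β y => if (e : Fin m × Fin r).1 = i then p i (e : Fin m × Fin r).2 else 0) c

theorem finrank_ker_constraintMatrix {m r : ℕ} (p : Fin m → Fin r → ℝ) (L : Fin m → ℝ) (β : ℝ)
    (y : Fin m × Fin r → ℝ) :
    Fintype.card {e // e ∉ frozen y} ≤
      Module.finrank ℝ (constraintMatrix p L β y).mulVecLin.ker +
        ((openJobs y).card + (tightMachines p L β y).card) := by
  have h1 := LinearMap.finrank_range_add_finrank_ker (constraintMatrix p L β y).mulVecLin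
  have h2 := Submodule.finrank_le (constraintMatrix p L β y).mulVecLin.range
  rw [Module.finrank_fintype_fun_eq_card] at h1 h2
  simp only [Fintype.card_sum, Fintype.card_coe] at h2
  omega

/-- Kernel rows preserve open job sums and tight loads. A machine that is not tight stays harmless,
since zero coordinates are frozen and its supported size cannot grow. -/
theorem add_mem_admissibleSet {m r : ℕ} {p : Fin m → Fin r → ℝ} (hp : ∀ i j, 0 ≤ p i j)
    {L : Fin m → ℝ} {β : ℝ} {y : Fin m × Fin r → ℝ} (hy : y ∈ admissibleSet p L β)
    {u : Fin m × Fin r → ℝ} (hu0 : ∀ e ∈ frozen y, u e = 0)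
    (hu : (fun e : {e // e ∉ frozen y} => u e) ∈ (constraintMatrix p L β y).mulVecLin.ker)
    (hc : ∀ e, (y + u) e ∈ Set.Icc (0 : ℝ) 1) : y + u ∈ admissibleSet p L β := by
  have hker := LinearMap.mem_ker.1 hu
  have hrow : ∀ c, ∑ e : {e // e ∉ frozen y}, constraintMatrix p L β y c e * u e = 0 :=
    fun c => congrFun hker c
  refine ⟨hc, fun j => ?_, fun i => ?_⟩
  · have hz : ∑ i, u (i, j) = 0 := by
      by_cases hj : j ∈ openJobs y
      · have h1 := hrow (Sum.inl ⟨j, hj⟩)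
        simp only [constraintMatrix, Sum.elim_inl] at h1
        rw [← sum_eq_sum_not_frozen (y := y) (fun e => (if e.2 = j then (1 : ℝ) else 0) * u e)
          fun e he => by rw [hu0 e he, mul_zero]] at h1
        simpa [Fintype.sum_prod_type] using h1
      · refine sum_eq_zero fun i _ => hu0 _ ?_
        by_contra h
        exact hj (by simpa [openJobs] using ⟨i, h⟩)
    simp only [Pi.add_apply, sum_add_distrib, hz, hy.2.1 j, add_zero]
  · by_cases hi : i ∈ tightMachines p L β y
    · left
      have h1 := hrow (Sum.inr ⟨i, hi⟩)
      simp only [constraintMatrix, Sum.elim_inr] at h1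
      rw [← sum_eq_sum_not_frozen (y := y) (fun e => (if e.1 = i then p i e.2 else 0) * u e)
        fun e he => by rw [hu0 e he, mul_zero]] at h1
      have h2 : ∑ j, p i j * u (i, j) = 0 := by
        rw [← h1, Fintype.sum_prod_type, sum_eq_single i (by
          intro k _ hk
          simp [hk]) (by simp)]
        simp
      have h3 : ∑ j, p i j * y (i, j) = L i := by
        refine (hy.2.2 i).resolve_right fun h => ?_
        simp only [tightMachines, mem_filter, mem_univ, true_and] at hi
        exact absurd h (not_le.2 hi)
      simp only [Pi.add_apply, mul_add, sum_add_distrib, h2, h3, add_zero]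
    · right
      simp only [tightMachines, mem_filter, mem_univ, true_and, not_lt] at hi
      refine le_trans (sum_le_sum fun j _ => ?_) hi
      by_cases h0 : y (i, j) = 0
      · have h1 : u (i, j) = 0 := hu0 _ (mem_frozen.2 (Or.inl h0))
        simp [h0, h1]
      · rw [if_neg h0]
        split_ifs
        · exact hp i j
        · exact le_rfl

/-- Each open job has at least two coordinates that are not frozen. -/
theorem two_le_card_open {m r : ℕ} {y : Fin m × Fin r → ℝ}
    (hy : ∀ e, y e ∈ Set.Icc (0 : ℝ) 1) (hsum : ∀ j, ∑ i, y (i, j) = 1) {j : Fin r}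
    (hj : j ∈ openJobs y) :
    ∑ i, (if (i, j) ∈ frozen y then 0 else y (i, j)) = 1 ∧
      (2 : ℝ) ≤ ∑ i, (if (i, j) ∈ frozen y then 0 else 1) := by
  simp only [openJobs, mem_filter, mem_univ, true_and] at hj
  obtain ⟨i₀, hi₀⟩ := hj
  have hi₀' := hi₀
  rw [mem_frozen, not_or] at hi₀'
  have hpos : 0 < y (i₀, j) := lt_of_le_of_ne (hy _).1 (Ne.symm hi₀'.1)
  have hlt : ∀ i, y (i, j) ≠ 1 := by
    intro i h1
    have hne : i ≠ i₀ := by rintro rfl; exact hi₀'.2 h1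
    have h2 : y (i, j) + y (i₀, j) ≤ ∑ i, y (i, j) := by
      rw [← sum_pair (f := fun i => y (i, j)) hne]
      exact sum_le_sum_of_subset_of_nonneg (subset_univ _) fun _ _ _ => (hy _).1
    rw [hsum] at h2
    linarith
  have hone : ∑ i, (if (i, j) ∈ frozen y then 0 else y (i, j)) = 1 := by
    rw [← hsum j]
    refine sum_congr rfl fun i _ => ?_
    split_ifs with h
    · exact ((mem_frozen.1 h).resolve_right (hlt i)).symm
    · rfl
  refine ⟨hone, ?_⟩
  -- The unfrozen values sum to 1 and are each below 1, so there is more than one of them;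
  -- integrality gives two.
  have h1 : (1 : ℝ) < ∑ i, (if (i, j) ∈ frozen y then 0 else 1) := by
    refine hone.symm.trans_lt (sum_lt_sum (fun i _ => ?_) ⟨i₀, mem_univ _, ?_⟩)
    · split_ifs
      · exact le_rfl
      · exact (hy _).2
    · rw [if_neg hi₀, if_neg hi₀]
      exact lt_of_le_of_ne (hy _).2 hi₀'.2
  have h2 : ∑ i, (if (i, j) ∈ frozen y then (0 : ℝ) else 1) =
      ((∑ i, (if (i, j) ∈ frozen y then 0 else 1) : ℕ) : ℝ) := by
    push_cast
    rfl
  rw [h2] at h1 ⊢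
  exact_mod_cast h1

theorem card_constraints_le {m r : ℕ} {p : Fin m → Fin r → ℝ} (hp : ∀ i j, 0 ≤ p i j)
    {L : Fin m → ℝ} {δ : ℝ} (hδ0 : 0 ≤ δ) (hδ : δ < 1 / 2) {y : Fin m × Fin r → ℝ}
    (hy : y ∈ admissibleSet p L (UnrelatedMachines.pmax p / (1 - 2 * δ)))
    (hex : ∃ e, e ∉ frozen y) :
    (openJobs y).card + (tightMachines p L (UnrelatedMachines.pmax p / (1 - 2 * δ)) y).card <
        Fintype.card {e // e ∉ frozen y} ∧
      ((openJobs y).card + (tightMachines p L (UnrelatedMachines.pmax p / (1 - 2 * δ)) y).card : ℝ)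
        ≤ (1 - δ) * Fintype.card {e // e ∉ frozen y} := by
  set P := UnrelatedMachines.pmax p with hP
  set J := openJobs y with hJ
  set T := tightMachines p L (P / (1 - 2 * δ)) y with hT
  have hk : 0 < 1 - 2 * δ := by linarith
  have hpP : ∀ i j, p i j ≤ P := fun i j =>
    le_ciSup (f := fun e : Fin m × Fin r => p e.1 e.2) (Set.finite_range _).bddAbove (i, j)
  have hA : (Fintype.card {e // e ∉ frozen y} : ℝ) =
      ∑ j, ∑ i, (if (i, j) ∈ frozen y then (0 : ℝ) else 1) := by
    rw [← Fintype.sum_prod_type_right (f := fun e => if e ∈ frozen y then (0 : ℝ) else 1),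
      sum_eq_sum_not_frozen (y := y) _ fun e he => if_pos he,
      sum_congr rfl fun (e : {e // e ∉ frozen y}) _ => if_neg e.2]
    simp
  have hclosed : ∀ j, j ∉ J → ∀ i, (i, j) ∈ frozen y := by
    intro j hj i
    by_contra h
    exact hj (by simpa [hJ, openJobs] using ⟨i, h⟩)
  have hopen := fun j (hj : j ∈ J) => two_le_card_open hy.1 hy.2.1 hj
  have hJA : 2 * (J.card : ℝ) ≤ Fintype.card {e // e ∉ frozen y} := by
    rw [hA]
    calc 2 * (J.card : ℝ) = ∑ j ∈ J, (2 : ℝ) := by rw [sum_const, nsmul_eq_mul]; ring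
      _ ≤ ∑ j ∈ J, ∑ i, (if (i, j) ∈ frozen y then (0 : ℝ) else 1) :=
          sum_le_sum fun j hj => (hopen j hj).2
      _ ≤ _ := sum_le_sum_of_subset_of_nonneg (subset_univ _) fun j _ _ =>
          sum_nonneg fun i _ => by split_ifs <;> norm_num
  have hJpos : 0 < (J.card : ℝ) := by
    obtain ⟨⟨i, j⟩, he⟩ := hex
    have : j ∈ J := by simpa [hJ, openJobs] using ⟨i, he⟩
    exact_mod_cast card_pos.2 ⟨j, this⟩
  -- `E i` is how much an open support could still fill up. Only open coordinates separate supported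
  -- size from load, so a tight machine needs `P * E i` above the allowed increase, while all `E i`
  -- add up to the open coordinates minus the open jobs.
  let E : Fin m → ℝ := fun i => ∑ j, (if (i, j) ∈ frozen y then 0 else 1 - y (i, j))
  have hE0 : ∀ i, 0 ≤ E i := fun i => sum_nonneg fun j _ => by
    split_ifs
    · exact le_rfl
    · linarith [(hy.1 (i, j)).2]
  have hEsum : ∑ i, E i = Fintype.card {e // e ∉ frozen y} - J.card := by
    have hJsum : (J.card : ℝ) = ∑ j, ∑ i, (if (i, j) ∈ frozen y then 0 else y (i, j)) := by
      rw [← sum_subset (subset_univ J) fun j _ hj => sum_eq_zero fun i _ =>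
        if_pos (hclosed j hj i), sum_congr rfl fun j hj => (hopen j hj).1]
      simp
    rw [hA, hJsum, ← sum_sub_distrib, sum_comm]
    refine sum_congr rfl fun j _ => ?_
    rw [← sum_sub_distrib]
    refine sum_congr rfl fun i _ => ?_
    split_ifs <;> simp
  have hexcess : ∀ i ∈ T, 1 < (1 - 2 * δ) * E i := by
    intro i hi
    simp only [hT, tightMachines, mem_filter, mem_univ, true_and] at hi
    have h1 := (hy.2.2 i).resolve_right (not_le.2 hi)
    have h2 : ∑ j, (if y (i, j) = 0 then 0 else p i j) - ∑ j, p i j * y (i, j) ≤ P * E i := by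
      rw [← sum_sub_distrib, mul_sum]
      refine sum_le_sum fun j _ => ?_
      by_cases h0 : y (i, j) = 0
      · rw [if_pos h0, if_pos (mem_frozen.2 (Or.inl h0)), h0]; simp
      by_cases h3 : y (i, j) = 1
      · rw [if_neg h0, if_pos (mem_frozen.2 (Or.inr h3)), h3]; simp
      · rw [if_neg h0, if_neg (fun h => (mem_frozen.1 h).elim h0 h3)]
        have := mul_le_mul_of_nonneg_right (hpP i j)
          (show 0 ≤ 1 - y (i, j) by linarith [(hy.1 (i, j)).2])
        linarith
    have h4 : P / (1 - 2 * δ) < P * E i := by linarith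
    rw [div_lt_iff₀ hk] at h4
    have hP0 : 0 ≤ P := Real.iSup_nonneg fun e => hp e.1 e.2
    have hPpos : 0 < P := by
      rcases hP0.lt_or_eq with h | h
      · exact h
      · rw [← h] at h4; simp at h4
    by_contra! hle
    have := mul_le_mul_of_nonneg_left hle hPpos.le
    linarith
  have hsumT : ∑ i ∈ T, E i ≤ Fintype.card {e // e ∉ frozen y} - J.card := by
    rw [← hEsum]
    exact sum_le_sum_of_subset_of_nonneg (subset_univ _) fun i _ _ => hE0 i
  have hTle : (T.card : ℝ) ≤ (1 - 2 * δ) * (Fintype.card {e // e ∉ frozen y} - J.card) := by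
    calc (T.card : ℝ) = ∑ i ∈ T, (1 : ℝ) := by simp
      _ ≤ ∑ i ∈ T, (1 - 2 * δ) * E i := sum_le_sum fun i hi => (hexcess i hi).le
      _ ≤ _ := by rw [← mul_sum]; exact mul_le_mul_of_nonneg_left hsumT hk.le
  constructor
  · have hlt : (T.card : ℝ) < Fintype.card {e // e ∉ frozen y} - J.card := by
      rcases T.eq_empty_or_nonempty with h | h
      · rw [h]; simp only [card_empty, Nat.cast_zero]; linarith
      · calc (T.card : ℝ) = ∑ i ∈ T, (1 : ℝ) := by simp
          _ < ∑ i ∈ T, E i := sum_lt_sum_of_nonempty h fun i hi => by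
              have h1 := hexcess i hi
              have h2 := mul_nonneg hδ0 (hE0 i)
              linarith
          _ ≤ _ := hsumT
    have : ((J.card + T.card : ℕ) : ℝ) < Fintype.card {e // e ∉ frozen y} := by
      push_cast; linarith
    exact_mod_cast this
  -- With n open coordinates: J + T ≤ (1 - 2δ)n + 2δJ ≤ (1 - δ)n, by 2J ≤ n.
  · have := mul_le_mul_of_nonneg_left hJA hδ0
    linarith

/-- At an integral point the supported size is the load, so both alternatives bound it. -/
theorem indicatorVec_mem_admissibleSet {m r : ℕ} {p : Fin m → Fin r → ℝ} {L : Fin m → ℝ} {β : ℝ}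
    (hβ : 0 ≤ β) {S : Finset (Fin m × Fin r)} (hS : indicatorVec S ∈ admissibleSet p L β) :
    UnrelatedMachines.IsIntegralAssignment (fun i j => indicatorVec S (i, j)) ∧
      ∀ i, UnrelatedMachines.load p (fun i j => indicatorVec S (i, j)) i ≤ L i + β := by
  have h01 : ∀ e, indicatorVec S e = 0 ∨ indicatorVec S e = 1 := by
    intro e; by_cases h : e ∈ S <;> simp [indicatorVec, h]
  refine ⟨⟨fun i j => h01 _, hS.2.1⟩, fun i => ?_⟩
  unfold UnrelatedMachines.load
  rcases hS.2.2 i with h | h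
  · linarith
  · refine (sum_congr rfl fun j _ => ?_).trans_le h
    rcases h01 (i, j) with h0 | h0 <;> simp [h0]

/-! ### Assembly of the rounding -/

theorem mainTheorem3 :
    ∃ C : ℝ, 0 < C ∧
      ∀ (m r : ℕ) (p : Fin m → Fin r → ℝ), (∀ i j, 0 ≤ p i j) →
      ∀ δ : ℝ, 0 ≤ δ → δ < 1 / 2 →
      ∀ x : Fin m → Fin r → ℝ, UnrelatedMachines.IsFractionalAssignment x →
      ∃ (Ω : Type) (_ : MeasurableSpace Ω) (μ : MeasureTheory.Measure Ω)
        (X : Fin m → Fin r → Ω → ℝ),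
        MeasureTheory.IsProbabilityMeasure μ ∧
        (∀ i j, Measurable (X i j)) ∧
        (∀ᵐ ω ∂μ, UnrelatedMachines.IsIntegralAssignment (fun i j => X i j ω) ∧
          ∀ i, UnrelatedMachines.load p (fun i j => X i j ω) i ≤
            UnrelatedMachines.load p x i + UnrelatedMachines.pmax p / (1 - 2 * δ)) ∧
        (∀ i j, ∫ ω, X i j ω ∂μ = x i j) ∧
        (0 < δ → UnrelatedMachines.IsConcentrated μ
          (fun (e : Fin m × Fin r) ω => X e.1 e.2 ω) (fun e => x e.1 e.2) (C / δ)) := by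
  refine ⟨12, by norm_num, fun m r p hp δ hδ0 hδ x hx => ?_⟩
  set β := UnrelatedMachines.pmax p / (1 - 2 * δ) with hβ
  have hβ0 : 0 ≤ β := div_nonneg (Real.iSup_nonneg fun e => hp e.1 e.2) (by linarith)
  set L := UnrelatedMachines.load p x with hL
  set x' : Fin m × Fin r → ℝ := fun e => x e.1 e.2 with hx'
  have hx'cube : ∀ e, x' e ∈ Set.Icc (0 : ℝ) 1 := fun e => hx.mem_Icc e.1 e.2
  have hmem : x' ∈ admissibleSet p L β := ⟨hx'cube, hx.sum_eq_one, fun i => Or.inl rfl⟩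
  -- for `δ = 0` only a nonzero direction is available, which is balanced with a tiny parameter
  obtain ⟨η, hη0, hη1, hηδ, hηdim⟩ : ∃ η : ℝ, 0 < η ∧ η ≤ 1 ∧ (0 < δ → η = δ) ∧
      (η ≤ δ ∨ η * Fintype.card (Fin m × Fin r) ≤ 1) := by
    rcases hδ0.lt_or_eq with h | h
    · exact ⟨δ, h, by linarith, fun _ => rfl, Or.inl le_rfl⟩
    · have hn : (0 : ℝ) ≤ Fintype.card (Fin m × Fin r) := Nat.cast_nonneg _
      refine ⟨1 / (Fintype.card (Fin m × Fin r) + 1), by positivity, ?_, fun h' => ?_, Or.inr ?_⟩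
      · rw [div_le_one (by positivity)]; linarith
      · exact absurd h h'.ne
      · rw [div_mul_eq_mul_div, div_le_one (by positivity)]; linarith
  obtain ⟨w, hw⟩ := exists_isPartialRounding_of_finrank hη0 hη1
    (fun y (hy : y ∈ admissibleSet p L β) => hy.1) (fun y hy hex => by
      obtain ⟨h1, h2⟩ := card_constraints_le hp hδ0 hδ hy hex
      rw [← hβ] at h1 h2
      have h3 := finrank_ker_constraintMatrix p L β y
      refine ⟨(constraintMatrix p L β y).mulVecLin.ker, by omega, ?_,
        fun u hu0 hu hc => add_mem_admissibleSet hp hy hu0 hu hc⟩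
      have h4 : (Fintype.card {e // e ∉ frozen y} : ℝ) ≤
          Module.finrank ℝ (constraintMatrix p L β y).mulVecLin.ker +
            ((openJobs y).card + (tightMachines p L β y).card) := by exact_mod_cast h3
      -- Either the kernel has dimension at least δ times the number of open coordinates, or one
      -- dimension already suffices because `η` is tiny.
      rcases hηdim with h | h
      · have := mul_le_mul_of_nonneg_right h
          (Nat.cast_nonneg (α := ℝ) (Fintype.card {e // e ∉ frozen y}))
        linarith
      · have h5 : (1 : ℝ) ≤ Module.finrank ℝ (constraintMatrix p L β y).mulVecLin.ker := by
          exact_mod_cast (by omega : 1 ≤ Module.finrank ℝ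
            (constraintMatrix p L β y).mulVecLin.ker)
        have h6 : (Fintype.card {e // e ∉ frozen y} : ℝ) ≤ Fintype.card (Fin m × Fin r) := by
          exact_mod_cast Fintype.card_subtype_le _
        have := mul_le_mul_of_nonneg_left h6 hη0.le
        linarith) hmem
  have hone : ∑ S, w S = 1 := le_antisymm hw.mass_le (by simpa using hw.le_mass)
  have hmean : ∀ e, ∑ S, w S * indicatorVec S e = x' e := fun e =>
    sub_eq_zero.1 (abs_nonpos_iff.1 (hw.mean e))
  refine ⟨Finset (Fin m × Fin r), ⊤, weightMeasure w, fun i j S => indicatorVec S (i, j),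
    isProbabilityMeasure_weightMeasure hw.nonneg hone, fun i j => measurable_from_top,
    ae_weightMeasure fun S hS => ?_, fun i j => ?_, fun hδpos => ?_⟩
  · refine indicatorVec_mem_admissibleSet hβ0 ?_
    by_contra h
    exact hS (hw.support S h)
  · rw [integral_weightMeasure hw.nonneg, hmean]
  · rw [← hηδ hδpos]
    exact isConcentrated_weightMeasure hη0 hη1 hx'cube hw hone hmean
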